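/- Let $a>0$, $b<0$, $T>0$, $\Gamma=(-\tfrac12,\tfrac12)^2$, $D=\Gamma\times(b,a)\subset\mathbb{R}^3$ and $Q_T=D\times(0,T)$, with points $(\mathbf{x},\tau)=(x,y,z,\tau)$. Put $\Gamma_m=\Gamma\times\{a\}$, $\Gamma_b=\Gamma\times\{b\}$ and $\Gamma_3=\partial D\setminus(\Gamma_m\cup\Gamma_b)$, and let $\partial_\nu$ be the outward normal derivative on $\partial D$. All boundary and initial values below are traces. For every $C>0$ there is a constant $C_1=C_1(C,Q_T)>0$ with the following property. Let $\widetilde g=\widetilde g(x,y,t)\in H^2(\Gamma_m\times(0,T))$ be real-valued, and suppose that there is a solution $u\in H^2(Q_T)$ of $$u_{\tau\tau}=\Delta u \ \text{ in } Q_T,\qquad u(\mathbf{x},0)=u_\tau(\mathbf{x},0)=0 \ \text{ in } D,$$ $$u|_{\Gamma_m\times(0,T)}=\widetilde g(x,y,T-\tau),\qquad (\partial_\nu u+u_\tau)|_{\Gamma_b\times(0,T)}=0,\qquad \partial_\nu u|_{\Gamma_3\times(0,T)}=0.$$ Suppose also that there is a function $F\in H^2(Q_T)$ with $$F(\mathbf{x},0)=F_\tau(\mathbf{x},0)=0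 \ \text{ in } D,\qquad (\partial_\nu F+F_\tau)|_{\Gamma_b\times(0,T)}=0,\qquad \partial_\nu F|_{\Gamma_3\times(0,T)}=0,$$ $$F|_{\Gamma_m\times(0,T)}=\widetilde g(x,y,T-\tau),\qquad \|F\|_{H^2(Q_T)}\le C\,\|\widetilde g\|_{H^2(\Gamma_m\times(0,T))}.$$ Then $u$ is the only solution of this problem in $H^2(Q_T)$, and $$\|u\|_{H^1(Q_T)}\le C_1\,\|\widetilde g\|_{H^2(\Gamma_m\times(0,T))}.$$ -/

import Mathlib

open MeasureTheory Filter Topology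
open scoped ContDiff

noncomputable section

namespace TimeReversal

/-- The open box with corners `lo` and `hi` in `ℝⁿ`. -/
def box {n : ℕ} (lo hi : Fin n → ℝ) : Set (Fin n → ℝ) :=
  {p | ∀ i, lo i < p i ∧ p i < hi i}

/-! ### Sobolev spaces on open subsets of `ℝⁿ` -/

/-- `v` is the weak partial derivative `∂u/∂xᵢ` on `Ω`. -/
def HasWeakDeriv {n : ℕ} (Ω : Set (Fin n → ℝ)) (i : Fin n) (u v : (Fin n → ℝ) → ℝ) : Prop :=
  LocallyIntegrableOn u Ω volume ∧ LocallyIntegrableOn v Ω volume ∧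
    ∀ φ : (Fin n → ℝ) → ℝ, ContDiff ℝ ∞ φ → HasCompactSupport φ → tsupport φ ⊆ Ω →
      ∫ p in Ω, u p * fderiv ℝ φ p (Pi.single i 1) = -∫ p in Ω, v p * φ p

/-- The weak partial derivative `∂u/∂xᵢ` on `Ω`, determined up to a null set of `Ω` where it
exists. -/
def weakDeriv {n : ℕ} (Ω : Set (Fin n → ℝ)) (i : Fin n) (u : (Fin n → ℝ) → ℝ) :
    (Fin n → ℝ) → ℝ :=
  Classical.epsilon (HasWeakDeriv Ω i u)

/-- `u ∈ Hᵏ(Ω)`: all weak partial derivatives of `u` of order at most `k` exist and lie in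
`L²(Ω)`. -/
def MemH {n : ℕ} (Ω : Set (Fin n → ℝ)) : ℕ → ((Fin n → ℝ) → ℝ) → Prop
  | 0, u => MemLp u 2 (volume.restrict Ω)
  | k + 1, u => MemLp u 2 (volume.restrict Ω) ∧
      ∀ i, ∃ v, HasWeakDeriv Ω i u v ∧ MemH Ω k v

/-- The squared norm of `L²(Ω)`. -/
def l2NormSq {n : ℕ} (Ω : Set (Fin n → ℝ)) (u : (Fin n → ℝ) → ℝ) : ℝ :=
  ∫ p in Ω, u p ^ 2

/-- The norm of `H¹(Ω)`. -/
def h1Norm {n : ℕ} (Ω : Set (Fin n → ℝ)) (u : (Fin n → ℝ) → ℝ) : ℝ :=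
  Real.sqrt (l2NormSq Ω u + ∑ i, l2NormSq Ω (weakDeriv Ω i u))

/-- The norm of `H²(Ω)`; the second-order multi-indices correspond to the pairs `i ≤ j`. -/
def h2Norm {n : ℕ} (Ω : Set (Fin n → ℝ)) (u : (Fin n → ℝ) → ℝ) : ℝ :=
  Real.sqrt (l2NormSq Ω u + ∑ i, l2NormSq Ω (weakDeriv Ω i u) +
    ∑ i, ∑ j ∈ Finset.Ici i, l2NormSq Ω (weakDeriv Ω j (weakDeriv Ω i u)))

/-! ### Traces on the faces of a box -/

/-- `h ∈ L²` is the trace of `v ∈ H¹(box lo hi)` on the face `xᵢ = c` of the box, where `c` is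
`lo i` or `hi i`. The face is parametrized by the remaining coordinates. The trace operator is
the extension by continuity of the restriction to the face from functions smooth up to the
boundary to all of `H¹`. -/
def IsTrace {n : ℕ} (lo hi : Fin (n + 1) → ℝ) (i : Fin (n + 1)) (c : ℝ)
    (v : (Fin (n + 1) → ℝ) → ℝ) (h : (Fin n → ℝ) → ℝ) : Prop :=
  MemH (box lo hi) 1 v ∧
  MemLp h 2 (volume.restrict (box (i.removeNth lo) (i.removeNth hi))) ∧
  ∃ φ : ℕ → (Fin (n + 1) → ℝ) → ℝ, (∀ k, ContDiff ℝ ∞ (φ k)) ∧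
    Tendsto (fun k => h1Norm (box lo hi) (fun p => φ k p - v p)) atTop (𝓝 0) ∧
    Tendsto (fun k => l2NormSq (box (i.removeNth lo) (i.removeNth hi))
      (fun y => φ k (i.insertNth c y) - h y)) atTop (𝓝 0)

/-! ### The time-reversed data-propagation problem

Points of space-time are `(x, y, z, τ)`, with indices `0, 1, 2, 3`. -/

/-- Lower corner of `Q_T`. -/
def qLo (b : ℝ) : Fin 4 → ℝ := ![-1 / 2, -1 / 2, b, 0]

/-- Upper corner of `Q_T`. -/
def qHi (a T : ℝ) : Fin 4 → ℝ := ![1 / 2, 1 / 2, a, T]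

/-- `Q_T = D × (0, T)` with `D = (-1/2, 1/2) × (-1/2, 1/2) × (b, a)`. -/
def QT (a b T : ℝ) : Set (Fin 4 → ℝ) := box (qLo b) (qHi a T)

/-- `Γ_m × (0, T)`, in the coordinates `(x, y, t)` of the face `z = a`. -/
def GammaM (T : ℝ) : Set (Fin 3 → ℝ) := box ![-1 / 2, -1 / 2, 0] ![1 / 2, 1 / 2, T]

/-- The homogeneous conditions of the problem on `u ∈ H²(Q_T)`. -/
structure HomogeneousConditions (a b T : ℝ) (u : (Fin 4 → ℝ) → ℝ) : Prop where
  /-- `u = 0` at `τ = 0` -/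
  initial : IsTrace (qLo b) (qHi a T) 3 0 u 0
  /-- `u_τ = 0` at `τ = 0` -/
  initial_deriv : IsTrace (qLo b) (qHi a T) 3 0 (weakDeriv (QT a b T) 3 u) 0
  /-- `∂_ν u + u_τ = 0` on `Γ_b × (0, T)`, where `∂_ν = -∂_z` -/
  absorbing : IsTrace (qLo b) (qHi a T) 2 b
    (fun p => -weakDeriv (QT a b T) 2 u p + weakDeriv (QT a b T) 3 u p) 0
  /-- `∂_ν u = 0` on the face `x = -1/2` -/
  neumann_x_lo : IsTrace (qLo b) (qHi a T) 0 (-1 / 2) (fun p => -weakDeriv (QT a b T) 0 u p) 0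
  /-- `∂_ν u = 0` on the face `x = 1/2` -/
  neumann_x_hi : IsTrace (qLo b) (qHi a T) 0 (1 / 2) (weakDeriv (QT a b T) 0 u) 0
  /-- `∂_ν u = 0` on the face `y = -1/2` -/
  neumann_y_lo : IsTrace (qLo b) (qHi a T) 1 (-1 / 2) (fun p => -weakDeriv (QT a b T) 1 u p) 0
  /-- `∂_ν u = 0` on the face `y = 1/2` -/
  neumann_y_hi : IsTrace (qLo b) (qHi a T) 1 (1 / 2) (weakDeriv (QT a b T) 1 u) 0

/-- The Dirichlet condition `u(x, y, a, τ) = g(x, y, T - τ)` on `Γ_m × (0, T)`. -/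
def DirichletData (a b T : ℝ) (g : (Fin 3 → ℝ) → ℝ) (u : (Fin 4 → ℝ) → ℝ) : Prop :=
  IsTrace (qLo b) (qHi a T) 2 a u (fun y => g ![y 0, y 1, T - y 2])

/-- `u ∈ H²(Q_T)` solves the time-reversed data-propagation problem with data `g`. -/
structure IsSolution (a b T : ℝ) (g : (Fin 3 → ℝ) → ℝ) (u : (Fin 4 → ℝ) → ℝ) : Prop where
  memH : MemH (QT a b T) 2 u
  /-- `u_ττ = u_xx + u_yy + u_zz` in `Q_T` -/
  wave : ∀ᵐ p ∂volume.restrict (QT a b T),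
    weakDeriv (QT a b T) 3 (weakDeriv (QT a b T) 3 u) p =
      weakDeriv (QT a b T) 0 (weakDeriv (QT a b T) 0 u) p +
      weakDeriv (QT a b T) 1 (weakDeriv (QT a b T) 1 u) p +
      weakDeriv (QT a b T) 2 (weakDeriv (QT a b T) 2 u) p
  homogeneous : HomogeneousConditions a b T u
  dirichlet : DirichletData a b T g u

/-- `F ∈ H²(Q_T)` is a lifting of the Dirichlet data that satisfies the homogeneous conditions,
with `‖F‖_{H²(Q_T)} ≤ C ‖g‖_{H²(Γ_m × (0, T))}`. -/
structure IsLifting (a b T C : ℝ) (g : (Fin 3 → ℝ) → ℝ) (F : (Fin 4 → ℝ) → ℝ) : Prop where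
  memH : MemH (QT a b T) 2 F
  homogeneous : HomogeneousConditions a b T F
  dirichlet : DirichletData a b T g F
  bound : h2Norm (QT a b T) F ≤ C * h2Norm (GammaM T) g

end TimeReversal

end

/-!
The difference `w` of two solutions, or of the solution `u` and the lifting `F`, satisfies all
boundary and initial conditions homogeneously, and `□w` is `0`, respectively `-□F`. Multiply
`□w` by `(T - τ) w_τ` and integrate over `Q_T`. Integration by parts in `τ` produces half the
integral of `w_τ² + |∇w|²` from the weight, with no boundary term, since the weight vanishes at
`τ = T` and the first derivatives of `w` vanish at `τ = 0`. Integration by parts in `x`, `y`, `z`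
produces the fluxes of `w_τ ∂_ν w`, which are non-positive: `w_τ` vanishes on `Γ_m`, `∂_ν w`
vanishes on `Γ_3`, and `∂_ν w = -w_τ` on `Γ_b`. Hence the `L²` norm of `□w` controls that of
the gradient, and through Poincaré's inequality in `τ` the full `H¹` norm.

The derivatives of `w` lie only in `H¹`, so the fluxes are expressed as integrals over `Q_T` against
test functions that vanish on the opposite face, and these pass to the limit along smooth
approximations. Tangential derivatives of a function with zero trace have zero trace only in this
weak sense: move the tangential derivative onto the test function.
-/

noncomputable section

namespace TimeReversal

/-! ### Convergence in `L²` -/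

/-- `F k → f` in `L²(μ)`, for a sequence of square-integrable functions. -/
structure L2Tendsto {α : Type*} [MeasurableSpace α] (μ : Measure α) (F : ℕ → α → ℝ)
    (f : α → ℝ) : Prop where
  memLp : ∀ k, MemLp (F k) 2 μ
  memLp_lim : MemLp f 2 μ
  tendsto : Tendsto (fun k => eLpNorm (F k - f) 2 μ) atTop (𝓝 0)

section L2

variable {α : Type*} [MeasurableSpace α] {μ : Measure α} {f g m : α → ℝ}

lemma inner_toLp (hf : MemLp f 2 μ) (hg : MemLp g 2 μ) :
    inner ℝ (hf.toLp f) (hg.toLp g) = ∫ x, f x * g x ∂μ := by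
  rw [L2.inner_def]
  refine integral_congr_ae ?_
  filter_upwards [hf.coeFn_toLp, hg.coeFn_toLp] with x hfx hgx
  simp [hfx, hgx, mul_comm]

lemma eLpNorm_two_eq_ofReal_sqrt (hf : MemLp f 2 μ) :
    eLpNorm f 2 μ = ENNReal.ofReal √(∫ x, f x ^ 2 ∂μ) := by
  simp [hf.eLpNorm_eq_integral_rpow_norm two_ne_zero ENNReal.ofNat_ne_top, Real.sqrt_eq_rpow]

lemma integral_add_sq_le (hf : MemLp f 2 μ) (hg : MemLp g 2 μ) :
    ∫ x, (f + g) x ^ 2 ∂μ ≤ 2 * ∫ x, f x ^ 2 ∂μ + 2 * ∫ x, g x ^ 2 ∂μ := by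
  have hf' := hf.integrable_sq.const_mul 2
  have hg' := hg.integrable_sq.const_mul 2
  rw [← integral_const_mul, ← integral_const_mul, ← integral_add hf' hg']
  refine integral_mono (hf.add hg).integrable_sq (hf'.add hg') fun x => ?_
  simpa [mul_add] using add_sq_le (a := f x) (b := g x)

namespace L2Tendsto

variable {F G : ℕ → α → ℝ}

lemma of_tendsto_integral_sq (hF : ∀ k, MemLp (F k) 2 μ) (hf : MemLp f 2 μ)
    (h : Tendsto (fun k => ∫ x, (F k x - f x) ^ 2 ∂μ) atTop (𝓝 0)) : L2Tendsto μ F f where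
  memLp := hF
  memLp_lim := hf
  tendsto := by
    simpa [eLpNorm_two_eq_ofReal_sqrt ((hF _).sub hf)] using ENNReal.tendsto_ofReal h.sqrt

lemma const (hf : MemLp f 2 μ) : L2Tendsto μ (fun _ => f) f where
  memLp _ := hf
  memLp_lim := hf
  tendsto := by simp

lemma sub (hF : L2Tendsto μ F f) (hG : L2Tendsto μ G g) :
    L2Tendsto μ (fun k => F k - G k) (f - g) where
  memLp k := (hF.memLp k).sub (hG.memLp k)
  memLp_lim := hF.memLp_lim.sub hG.memLp_lim
  tendsto := by
    refine tendsto_of_tendsto_of_tendsto_of_le_of_le tendsto_const_nhds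
      (by simpa using hF.tendsto.add hG.tendsto) (fun _ => zero_le) fun k => ?_
    rw [sub_sub_sub_comm]
    exact eLpNorm_sub_le ((hF.memLp k).sub hF.memLp_lim).1 ((hG.memLp k).sub hG.memLp_lim).1
      one_le_two

lemma bdd_mul {M : ℝ} (hm : AEStronglyMeasurable m μ) (hM : ∀ᵐ x ∂μ, ‖m x‖ ≤ M)
    (hF : L2Tendsto μ F f) : L2Tendsto μ (fun k => m * F k) (m * f) where
  memLp k := (hF.memLp k).mul (memLp_top_of_bound hm M hM)
  memLp_lim := hF.memLp_lim.mul (memLp_top_of_bound hm M hM)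
  tendsto := by
    refine tendsto_of_tendsto_of_tendsto_of_le_of_le tendsto_const_nhds
      (by simpa using ENNReal.Tendsto.const_mul hF.tendsto (.inr ENNReal.ofReal_ne_top))
      (fun _ => zero_le) fun k => eLpNorm_le_mul_eLpNorm_of_ae_le_mul (c := M) ?_ 2
    filter_upwards [hM] with x hx
    rw [← mul_sub, Pi.mul_apply, norm_mul]
    gcongr

lemma integral_mul (hF : L2Tendsto μ F f) (hG : L2Tendsto μ G g) :
    Tendsto (fun k => ∫ x, F k x * G k x ∂μ) atTop (𝓝 (∫ x, f x * g x ∂μ)) := by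
  have tendsto_toLp {F : ℕ → α → ℝ} {f : α → ℝ} (h : L2Tendsto μ F f) :
      Tendsto (fun k => (h.memLp k).toLp (F k)) atTop (𝓝 (h.memLp_lim.toLp f)) :=
    (Lp.tendsto_Lp_iff_tendsto_eLpNorm'' _ _ _ _).2 h.tendsto
  simpa only [inner_toLp] using (tendsto_toLp hF).inner (𝕜 := ℝ) (tendsto_toLp hG)

end L2Tendsto

end L2

/-! ### Boxes -/

section Box

variable {n : ℕ} {lo hi : Fin n → ℝ} {m f g : (Fin n → ℝ) → ℝ}

lemma box_eq_pi : box lo hi = Set.pi Set.univ fun i => Set.Ioo (lo i) (hi i) := by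
  ext p
  simp [box]

lemma isOpen_box : IsOpen (box lo hi) := by
  rw [box_eq_pi]
  exact isOpen_set_pi Set.finite_univ fun _ _ => isOpen_Ioo

lemma box_ae_eq_Icc : box lo hi =ᵐ[volume] Set.Icc lo hi := by
  rw [box_eq_pi]
  exact Measure.univ_pi_Ioo_ae_eq_Icc

lemma box_subset_Icc : box lo hi ⊆ Set.Icc lo hi := fun _ hp =>
  ⟨fun i => (hp i).1.le, fun i => (hp i).2.le⟩

lemma ae_restrict_box {P : (Fin n → ℝ) → Prop} (h : ∀ x ∈ box lo hi, P x) :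
    ∀ᵐ x ∂volume.restrict (box lo hi), P x :=
  ae_restrict_of_forall_mem isOpen_box.measurableSet h

instance isFiniteMeasure_restrict_box : IsFiniteMeasure (volume.restrict (box lo hi)) :=
  isFiniteMeasure_restrict.2
    ((measure_mono box_subset_Icc).trans_lt isCompact_Icc.measure_lt_top).ne

lemma exists_norm_le_on_box (hm : Continuous m) :
    ∃ M, ∀ᵐ x ∂volume.restrict (box lo hi), ‖m x‖ ≤ M := by
  obtain ⟨M, hM⟩ := (isCompact_Icc (a := lo) (b := hi)).exists_bound_of_continuousOn
    hm.continuousOn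
  exact ⟨M, ae_restrict_box fun x hx => hM x (box_subset_Icc hx)⟩

lemma memLp_of_continuous (hm : Continuous m) : MemLp m 2 (volume.restrict (box lo hi)) := by
  obtain ⟨M, hM⟩ := exists_norm_le_on_box (lo := lo) (hi := hi) hm
  exact .of_bound hm.aestronglyMeasurable M hM

lemma memLp_continuous_mul (hm : Continuous m) (hf : MemLp f 2 (volume.restrict (box lo hi))) :
    MemLp (m * f) 2 (volume.restrict (box lo hi)) := by
  obtain ⟨M, hM⟩ := exists_norm_le_on_box (lo := lo) (hi := hi) hm
  exact hf.mul (memLp_top_of_bound hm.aestronglyMeasurable M hM)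

lemma integrable_continuous_mul_mul (hm : Continuous m)
    (hf : MemLp f 2 (volume.restrict (box lo hi)))
    (hg : MemLp g 2 (volume.restrict (box lo hi))) :
    Integrable (fun x => m x * f x * g x) (volume.restrict (box lo hi)) :=
  (memLp_continuous_mul hm hf).integrable_mul hg

lemma L2Tendsto.continuous_mul {F : ℕ → (Fin n → ℝ) → ℝ} (hm : Continuous m)
    (hF : L2Tendsto (volume.restrict (box lo hi)) F f) :
    L2Tendsto (volume.restrict (box lo hi)) (fun k => m * F k) (m * f) := by
  obtain ⟨M, hM⟩ := exists_norm_le_on_box (lo := lo) (hi := hi) hm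
  exact hF.bdd_mul hm.aestronglyMeasurable hM

end Box

/-! ### Classical partial derivatives -/

/-- The classical partial derivative `∂φ/∂xᵢ`. -/
def partialDeriv {n : ℕ} (i : Fin n) (φ : (Fin n → ℝ) → ℝ) : (Fin n → ℝ) → ℝ :=
  fun x => fderiv ℝ φ x (Pi.single i 1)

section PartialDeriv

variable {n : ℕ} {i j : Fin n} {φ ψ : (Fin n → ℝ) → ℝ}

lemma contDiff_partialDeriv (i : Fin n) (hφ : ContDiff ℝ ∞ φ) :
    ContDiff ℝ ∞ (partialDeriv i φ) :=
  (hφ.fderiv_right (m := ∞) (by simp)).clm_apply contDiff_const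

lemma partialDeriv_mul (i : Fin n) (hφ : Differentiable ℝ φ) (hψ : Differentiable ℝ ψ) :
    partialDeriv i (φ * ψ) = partialDeriv i φ * ψ + φ * partialDeriv i ψ := by
  funext x
  simp [partialDeriv, fderiv_mul (hφ x) (hψ x), mul_comm, add_comm]

lemma partialDeriv_add (i : Fin n) (hφ : Differentiable ℝ φ) (hψ : Differentiable ℝ ψ) :
    partialDeriv i (φ + ψ) = partialDeriv i φ + partialDeriv i ψ := by
  funext x
  simp [partialDeriv, fderiv_add (hφ x) (hψ x)]

lemma partialDeriv_sub (i : Fin n) (hφ : Differentiable ℝ φ) (hψ : Differentiable ℝ ψ) :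
    partialDeriv i (φ - ψ) = partialDeriv i φ - partialDeriv i ψ := by
  funext x
  simp [partialDeriv, fderiv_sub (hφ x) (hψ x)]

lemma partialDeriv_comm (i j : Fin n) (hφ : ContDiff ℝ 2 φ) :
    partialDeriv i (partialDeriv j φ) = partialDeriv j (partialDeriv i φ) := by
  funext x
  have hd : DifferentiableAt ℝ (fderiv ℝ φ) x :=
    (hφ.fderiv_right (m := 1) (by norm_num)).differentiable one_ne_zero x
  have partialDeriv_partialDeriv (i j : Fin n) : partialDeriv i (partialDeriv j φ) x =
      fderiv ℝ (fderiv ℝ φ) x (Pi.single i 1) (Pi.single j 1) := by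
    unfold partialDeriv
    simp [fderiv_clm_apply hd (differentiableAt_const _)]
  rw [partialDeriv_partialDeriv, partialDeriv_partialDeriv]
  exact hφ.contDiffAt.isSymmSndFDerivAt (by simp) _ _

lemma partialDeriv_eq_zero_of_line (hφ : Differentiable ℝ φ) {x : Fin n → ℝ}
    (h : ∀ s : ℝ, φ (x + s • Pi.single i 1) = φ x) : partialDeriv i φ x = 0 := by
  simp [partialDeriv, ← (hφ x).lineDeriv_eq_fderiv, lineDeriv, h]

lemma partialDeriv_eq_zero_of_hyperplane (hij : j ≠ i) (hφ : Differentiable ℝ φ) {c : ℝ}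
    (h : ∀ x, x i = c → φ x = 0) {x : Fin n → ℝ} (hx : x i = c) : partialDeriv j φ x = 0 :=
  partialDeriv_eq_zero_of_line hφ fun s => by
    rw [h x hx, h]
    simp [hx, hij.symm]

lemma partialDeriv_const_sub_apply (i j : Fin n) (c : ℝ) :
    partialDeriv i (fun x => c - x j) = fun _ => -(Pi.single i 1 : Fin n → ℝ) j := by
  funext x
  simp [partialDeriv, fderiv_const_sub, fderiv_apply]

end PartialDeriv

lemma integral_partialDeriv {n : ℕ} {lo hi : Fin (n + 1) → ℝ} (hle : lo ≤ hi) (i : Fin (n + 1))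
    {φ : (Fin (n + 1) → ℝ) → ℝ} (hφ : ContDiff ℝ 1 φ) :
    ∫ x in box lo hi, partialDeriv i φ x =
      (∫ y in box (i.removeNth lo) (i.removeNth hi), φ (i.insertNth (hi i) y)) -
        ∫ y in box (i.removeNth lo) (i.removeNth hi), φ (i.insertNth (lo i) y) := by
  have hdiv (x : Fin (n + 1) → ℝ) : ∑ j, (if j = i then fderiv ℝ φ x else 0) (Pi.single j 1) =
      partialDeriv i φ x := by
    rw [Finset.sum_eq_single i (fun j _ hj => by simp [hj]) (by simp)]
    simp [partialDeriv]
  have h := integral_divergence_of_hasFDerivAt_off_countable' lo hi hle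
    (fun j x => if j = i then φ x else 0) (fun j x => if j = i then fderiv ℝ φ x else 0)
    ∅ Set.countable_empty
    (fun j => by split_ifs; exacts [hφ.continuous.continuousOn, continuousOn_const])
    (fun x _ j => by
      split_ifs
      exacts [(hφ.differentiable one_ne_zero x).hasFDerivAt, hasFDerivAt_const _ _])
    (by
      simp only [hdiv]
      exact ((hφ.continuous_fderiv one_ne_zero).clm_apply continuous_const).continuousOn
        |>.integrableOn_compact isCompact_Icc)
  simp only [hdiv] at h
  rw [Finset.sum_eq_single i (fun j _ hj => by simp [hj]) (by simp)] at h
  simp only [if_true] at h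
  simp only [setIntegral_congr_set box_ae_eq_Icc]
  exact h

/-! ### Weighted inner products and boundary forms -/

/-- The inner product `∫ χ f g` of `f` and `g` over a box, with weight `χ`. -/
def weightedInner {n : ℕ} (lo hi : Fin n → ℝ) (χ f g : (Fin n → ℝ) → ℝ) : ℝ :=
  ∫ x in box lo hi, χ x * f x * g x

section WeightedInner

variable {n : ℕ} {lo hi : Fin n → ℝ} {χ χ' f f' g g' : (Fin n → ℝ) → ℝ}

lemma weightedInner_comm (χ f g : (Fin n → ℝ) → ℝ) :
    weightedInner lo hi χ f g = weightedInner lo hi χ g f :=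
  integral_congr_ae (ae_of_all _ fun _ => by ring)

@[simp]
lemma weightedInner_zero_left (χ g : (Fin n → ℝ) → ℝ) : weightedInner lo hi χ 0 g = 0 := by
  simp [weightedInner]

@[simp]
lemma weightedInner_zero_right (χ f : (Fin n → ℝ) → ℝ) : weightedInner lo hi χ f 0 = 0 := by
  simp [weightedInner]

@[simp]
lemma weightedInner_zero_weight (f g : (Fin n → ℝ) → ℝ) : weightedInner lo hi 0 f g = 0 := by
  simp [weightedInner]

lemma weightedInner_congr (χ : (Fin n → ℝ) → ℝ) (hf : f =ᵐ[volume.restrict (box lo hi)] f')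
    (hg : g =ᵐ[volume.restrict (box lo hi)] g') :
    weightedInner lo hi χ f g = weightedInner lo hi χ f' g' := by
  refine integral_congr_ae ?_
  filter_upwards [hf, hg] with x hfx hgx
  rw [hfx, hgx]

lemma weightedInner_sub_left (hχ : Continuous χ) (hf : MemLp f 2 (volume.restrict (box lo hi)))
    (hf' : MemLp f' 2 (volume.restrict (box lo hi)))
    (hg : MemLp g 2 (volume.restrict (box lo hi))) :
    weightedInner lo hi χ (f - f') g = weightedInner lo hi χ f g - weightedInner lo hi χ f' g := by
  simp only [weightedInner, Pi.sub_apply, mul_sub, sub_mul]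
  exact integral_sub (integrable_continuous_mul_mul hχ hf hg)
    (integrable_continuous_mul_mul hχ hf' hg)

lemma weightedInner_sum_left {ι : Type*} {s : Finset ι} {F : ι → (Fin n → ℝ) → ℝ}
    (hχ : Continuous χ) (hF : ∀ i ∈ s, MemLp (F i) 2 (volume.restrict (box lo hi)))
    (hg : MemLp g 2 (volume.restrict (box lo hi))) :
    weightedInner lo hi χ (∑ i ∈ s, F i) g = ∑ i ∈ s, weightedInner lo hi χ (F i) g := by
  simp only [weightedInner, Finset.sum_apply, Finset.mul_sum, Finset.sum_mul]
  exact integral_finsetSum s fun i hi => integrable_continuous_mul_mul hχ (hF i hi) hg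

lemma weightedInner_add_weight (hχ : Continuous χ) (hχ' : Continuous χ')
    (hf : MemLp f 2 (volume.restrict (box lo hi)))
    (hg : MemLp g 2 (volume.restrict (box lo hi))) :
    weightedInner lo hi (χ + χ') f g =
      weightedInner lo hi χ f g + weightedInner lo hi χ' f g := by
  simp only [weightedInner, Pi.add_apply, add_mul]
  exact integral_add (integrable_continuous_mul_mul hχ hf hg)
    (integrable_continuous_mul_mul hχ' hf hg)

lemma weightedInner_self_nonneg (hχ : ∀ x ∈ box lo hi, 0 ≤ χ x) :
    0 ≤ weightedInner lo hi χ f f :=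
  setIntegral_nonneg isOpen_box.measurableSet fun x hx => by
    rw [mul_assoc]
    exact mul_nonneg (hχ x hx) (mul_self_nonneg _)

lemma L2Tendsto.weightedInner {F G : ℕ → (Fin n → ℝ) → ℝ} (hχ : Continuous χ)
    (hF : L2Tendsto (volume.restrict (box lo hi)) F f)
    (hG : L2Tendsto (volume.restrict (box lo hi)) G g) :
    Tendsto (fun k => weightedInner lo hi χ (F k) (G k)) atTop (𝓝 (weightedInner lo hi χ f g)) :=
  (hF.continuous_mul hχ).integral_mul hG

end WeightedInner

/-- The weak form of the boundary integral `∫ χ p q νᵢ` over the surface of a box, in terms of the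
partial derivatives `p'` of `p` and `q'` of `q` in direction `i`. -/
def boundaryForm {n : ℕ} (lo hi : Fin n → ℝ) (i : Fin n) (χ p p' q q' : (Fin n → ℝ) → ℝ) : ℝ :=
  weightedInner lo hi (partialDeriv i χ) p q + weightedInner lo hi χ p' q +
    weightedInner lo hi χ p q'

section BoundaryForm

variable {n : ℕ} {lo hi : Fin n → ℝ} {i : Fin n}
  {χ χ' φ ψ p p' p'' q q' r r' : (Fin n → ℝ) → ℝ}

lemma boundaryForm_comm (i : Fin n) (χ p p' q q' : (Fin n → ℝ) → ℝ) :
    boundaryForm lo hi i χ p p' q q' = boundaryForm lo hi i χ q q' p p' := by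
  simp only [boundaryForm, weightedInner_comm _ q, weightedInner_comm _ q']
  ring

lemma boundaryForm_congr_deriv (h : p' =ᵐ[volume.restrict (box lo hi)] p'') :
    boundaryForm lo hi i χ p p' q q' = boundaryForm lo hi i χ p p'' q q' := by
  simp only [boundaryForm, weightedInner_congr χ h (ae_eq_refl q)]

section MemLp

variable (hχ : ContDiff ℝ ∞ χ) (hp : MemLp p 2 (volume.restrict (box lo hi)))
  (hp' : MemLp p' 2 (volume.restrict (box lo hi))) (hq : MemLp q 2 (volume.restrict (box lo hi)))
  (hq' : MemLp q' 2 (volume.restrict (box lo hi)))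

include hχ hp hp' hq hq'

lemma integrable_boundaryForm :
    Integrable (partialDeriv i χ * p * q + χ * p' * q + χ * p * q')
      (volume.restrict (box lo hi)) :=
  ((integrable_continuous_mul_mul (contDiff_partialDeriv i hχ).continuous hp hq).add
    (integrable_continuous_mul_mul hχ.continuous hp' hq)).add
    (integrable_continuous_mul_mul hχ.continuous hp hq')

lemma boundaryForm_eq_integral :
    boundaryForm lo hi i χ p p' q q' =
      ∫ x in box lo hi, (partialDeriv i χ * p * q + χ * p' * q + χ * p * q') x := by
  have h₁ := integrable_continuous_mul_mul (contDiff_partialDeriv i hχ).continuous hp hq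
  have h₂ := integrable_continuous_mul_mul hχ.continuous hp' hq
  have h₃ := integrable_continuous_mul_mul hχ.continuous hp hq'
  exact (integral_add' (h₁.add h₂) h₃ |>.trans (congrArg (· + _) (integral_add' h₁ h₂))).symm

lemma boundaryForm_sub_left (hr : MemLp r 2 (volume.restrict (box lo hi)))
    (hr' : MemLp r' 2 (volume.restrict (box lo hi))) :
    boundaryForm lo hi i χ (p - r) (p' - r') q q' =
      boundaryForm lo hi i χ p p' q q' - boundaryForm lo hi i χ r r' q q' := by
  unfold boundaryForm
  rw [weightedInner_sub_left (contDiff_partialDeriv i hχ).continuous hp hr hq,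
    weightedInner_sub_left hχ.continuous hp' hr' hq, weightedInner_sub_left hχ.continuous hp hr hq']
  ring

lemma boundaryForm_add_weight (hχ' : ContDiff ℝ ∞ χ') :
    boundaryForm lo hi i (χ + χ') p p' q q' =
      boundaryForm lo hi i χ p p' q q' + boundaryForm lo hi i χ' p p' q q' := by
  unfold boundaryForm
  rw [partialDeriv_add i (hχ.differentiable (by simp)) (hχ'.differentiable (by simp)),
    weightedInner_add_weight (contDiff_partialDeriv i hχ).continuous
      (contDiff_partialDeriv i hχ').continuous hp hq,
    weightedInner_add_weight hχ.continuous hχ'.continuous hp' hq,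
    weightedInner_add_weight hχ.continuous hχ'.continuous hp hq']
  ring

end MemLp

lemma boundaryForm_contDiff_right (hχ : ContDiff ℝ ∞ χ) (hφ : ContDiff ℝ ∞ φ)
    (hp : MemLp p 2 (volume.restrict (box lo hi)))
    (hp' : MemLp p' 2 (volume.restrict (box lo hi))) :
    boundaryForm lo hi i χ p p' φ (partialDeriv i φ) = boundaryForm lo hi i (χ * φ) p p' 1 0 := by
  have hχφ : ContDiff ℝ ∞ (χ * φ) := hχ.mul hφ
  rw [boundaryForm_eq_integral hχ hp hp' (memLp_of_continuous hφ.continuous)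
      (memLp_of_continuous (contDiff_partialDeriv i hφ).continuous),
    boundaryForm_eq_integral hχφ hp hp' (memLp_of_continuous continuous_one) MemLp.zero,
    partialDeriv_mul i (hχ.differentiable (by simp)) (hφ.differentiable (by simp))]
  refine congrArg (fun f : (Fin n → ℝ) → ℝ => ∫ x in box lo hi, f x) ?_
  ring

lemma boundaryForm_contDiff (hχ : ContDiff ℝ ∞ χ) (hφ : ContDiff ℝ ∞ φ) (hψ : ContDiff ℝ ∞ ψ) :
    boundaryForm lo hi i χ φ (partialDeriv i φ) ψ (partialDeriv i ψ) =
      ∫ x in box lo hi, partialDeriv i (χ * φ * ψ) x := by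
  have memLp {φ : (Fin n → ℝ) → ℝ} (hφ : ContDiff ℝ ∞ φ) :
      MemLp φ 2 (volume.restrict (box lo hi)) := memLp_of_continuous hφ.continuous
  have differentiable {φ : (Fin n → ℝ) → ℝ} (hφ : ContDiff ℝ ∞ φ) : Differentiable ℝ φ :=
    hφ.differentiable (by simp)
  have hχφ : Differentiable ℝ (χ * φ) := (differentiable hχ).mul (differentiable hφ)
  rw [boundaryForm_eq_integral hχ (memLp hφ) (memLp (contDiff_partialDeriv i hφ)) (memLp hψ)
      (memLp (contDiff_partialDeriv i hψ)),
    partialDeriv_mul i hχφ (differentiable hψ),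
    partialDeriv_mul i (differentiable hχ) (differentiable hφ)]
  refine congrArg (fun f : (Fin n → ℝ) → ℝ => ∫ x in box lo hi, f x) ?_
  ring

lemma L2Tendsto.boundaryForm {F F' G G' : ℕ → (Fin n → ℝ) → ℝ} (hχ : ContDiff ℝ ∞ χ)
    (hF : L2Tendsto (volume.restrict (box lo hi)) F p)
    (hF' : L2Tendsto (volume.restrict (box lo hi)) F' p')
    (hG : L2Tendsto (volume.restrict (box lo hi)) G q)
    (hG' : L2Tendsto (volume.restrict (box lo hi)) G' q') :
    Tendsto (fun k => boundaryForm lo hi i χ (F k) (F' k) (G k) (G' k)) atTop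
      (𝓝 (boundaryForm lo hi i χ p p' q q')) :=
  ((hF.weightedInner (contDiff_partialDeriv i hχ).continuous hG).add
    (hF'.weightedInner hχ.continuous hG)).add (hF.weightedInner hχ.continuous hG')

end BoundaryForm

/-! ### Traces of limits of smooth functions -/

/-- The restriction of a function to the hyperplane `xᵢ = c`. -/
def faceRestrict {n : ℕ} (i : Fin (n + 1)) (c : ℝ) (φ : (Fin (n + 1) → ℝ) → ℝ) :
    (Fin n → ℝ) → ℝ :=
  fun y => φ (i.insertNth c y)

/-- The smooth functions `φ k` converge in `H¹(Ω)` to `p`, whose gradient is `P`. -/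
structure H1Tendsto {n : ℕ} (Ω : Set (Fin n → ℝ)) (φ : ℕ → (Fin n → ℝ) → ℝ)
    (p : (Fin n → ℝ) → ℝ) (P : Fin n → (Fin n → ℝ) → ℝ) : Prop where
  contDiff : ∀ k, ContDiff ℝ ∞ (φ k)
  tendsto : L2Tendsto (volume.restrict Ω) φ p
  tendsto_partialDeriv : ∀ i, L2Tendsto (volume.restrict Ω) (fun k => partialDeriv i (φ k)) (P i)

/-- `p`, with gradient `P`, is an `H¹`-limit of smooth functions on the box whose restrictions to
the face `xᵢ = c` converge in `L²` to `h`. -/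
def HasTrace {n : ℕ} (lo hi : Fin (n + 1) → ℝ) (i : Fin (n + 1)) (c : ℝ)
    (p : (Fin (n + 1) → ℝ) → ℝ) (P : Fin (n + 1) → (Fin (n + 1) → ℝ) → ℝ)
    (h : (Fin n → ℝ) → ℝ) : Prop :=
  ∃ φ, H1Tendsto (box lo hi) φ p P ∧
    L2Tendsto (volume.restrict (box (i.removeNth lo) (i.removeNth hi)))
      (fun k => faceRestrict i c (φ k)) h

/-- Smooth functions that vanish on those of the two hyperplanes `xᵢ = lo i`, `xᵢ = hi i` which
differ from `xᵢ = c`; they are the test functions for a boundary condition on the face `xᵢ = c`. -/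
structure FaceTest {n : ℕ} (lo hi : Fin n → ℝ) (i : Fin n) (c : ℝ) (ψ : (Fin n → ℝ) → ℝ) :
    Prop where
  contDiff : ContDiff ℝ ∞ ψ
  eq_zero : ∀ x, x i = lo i ∨ x i = hi i → x i ≠ c → ψ x = 0

/-- `p`, with partial derivative `p'` in direction `i`, has zero trace on the face `xᵢ = c` in the
weak sense: it integrates by parts against test functions without boundary terms. -/
def WeakZeroTrace {n : ℕ} (lo hi : Fin n → ℝ) (i : Fin n) (c : ℝ) (p p' : (Fin n → ℝ) → ℝ) :
    Prop :=
  ∀ ψ, FaceTest lo hi i c ψ → boundaryForm lo hi i ψ p p' 1 0 = 0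

lemma FaceTest.mul_right {n : ℕ} {lo hi : Fin n → ℝ} {i : Fin n} {c : ℝ} {ψ χ : (Fin n → ℝ) → ℝ}
    (hψ : FaceTest lo hi i c ψ) (hχ : ContDiff ℝ ∞ χ) : FaceTest lo hi i c (ψ * χ) where
  contDiff := hψ.contDiff.mul hχ
  eq_zero x hx hc := by simp [hψ.eq_zero x hx hc]

lemma FaceTest.partialDeriv {n : ℕ} {lo hi : Fin n → ℝ} {i j : Fin n} {c : ℝ}
    {ψ : (Fin n → ℝ) → ℝ} (hψ : FaceTest lo hi i c ψ) (hij : j ≠ i) :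
    FaceTest lo hi i c (partialDeriv j ψ) where
  contDiff := contDiff_partialDeriv j hψ.contDiff
  eq_zero x hx hc := partialDeriv_eq_zero_of_hyperplane hij (hψ.contDiff.differentiable (by simp))
    (fun y hy => hψ.eq_zero y (by rwa [hy]) (by rwa [hy])) rfl

lemma continuous_faceRestrict {n : ℕ} (i : Fin (n + 1)) (c : ℝ) {φ : (Fin (n + 1) → ℝ) → ℝ}
    (hφ : Continuous φ) : Continuous (faceRestrict i c φ) :=
  hφ.comp (continuous_const.finInsertNth i continuous_id)

namespace H1Tendsto

variable {n : ℕ} {Ω : Set (Fin n → ℝ)} {φ ψ : ℕ → (Fin n → ℝ) → ℝ} {p q : (Fin n → ℝ) → ℝ}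
  {P Q : Fin n → (Fin n → ℝ) → ℝ}

lemma memLp (hp : H1Tendsto Ω φ p P) : MemLp p 2 (volume.restrict Ω) := hp.tendsto.memLp_lim

lemma memLp_deriv (hp : H1Tendsto Ω φ p P) (i : Fin n) : MemLp (P i) 2 (volume.restrict Ω) :=
  (hp.tendsto_partialDeriv i).memLp_lim

lemma sub (hp : H1Tendsto Ω φ p P) (hq : H1Tendsto Ω ψ q Q) :
    H1Tendsto Ω (fun k => φ k - ψ k) (p - q) (P - Q) where
  contDiff k := (hp.contDiff k).sub (hq.contDiff k)
  tendsto := hp.tendsto.sub hq.tendsto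
  tendsto_partialDeriv i := by
    simpa only [Pi.sub_apply, partialDeriv_sub i ((hp.contDiff _).differentiable (by simp))
      ((hq.contDiff _).differentiable (by simp))] using
      (hp.tendsto_partialDeriv i).sub (hq.tendsto_partialDeriv i)

lemma zero : H1Tendsto Ω 0 0 0 where
  contDiff _ := contDiff_zero_fun
  tendsto := .const MemLp.zero
  tendsto_partialDeriv i := by
    have : partialDeriv i (0 : (Fin n → ℝ) → ℝ) = 0 := by ext; simp [partialDeriv]
    simpa [this] using L2Tendsto.const MemLp.zero

lemma one [IsFiniteMeasure (volume.restrict Ω)] : H1Tendsto Ω 1 1 0 where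
  contDiff _ := contDiff_const
  tendsto := .const (memLp_const 1)
  tendsto_partialDeriv i := by
    have : partialDeriv i (1 : (Fin n → ℝ) → ℝ) = 0 := by ext; simp [partialDeriv]
    simpa [this] using L2Tendsto.const MemLp.zero

end H1Tendsto

section Traces

variable {n : ℕ} {lo hi : Fin (n + 1) → ℝ} {i : Fin (n + 1)} {c : ℝ}
  {χ p p' q : (Fin (n + 1) → ℝ) → ℝ} {P Q : Fin (n + 1) → (Fin (n + 1) → ℝ) → ℝ}
  {h k : (Fin n → ℝ) → ℝ} {φ ψ : ℕ → (Fin (n + 1) → ℝ) → ℝ}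

lemma HasTrace.sub (hp : HasTrace lo hi i c p P h) (hq : HasTrace lo hi i c q Q k) :
    HasTrace lo hi i c (p - q) (P - Q) (h - k) := by
  obtain ⟨φ, hφ, hh⟩ := hp
  obtain ⟨ψ, hψ, hk⟩ := hq
  exact ⟨_, hφ.sub hψ, hh.sub hk⟩

lemma HasTrace.neg (hp : HasTrace lo hi i c p P h) : HasTrace lo hi i c (-p) (-P) (-h) := by
  have h0 : HasTrace lo hi i c 0 0 0 := ⟨0, .zero, .const MemLp.zero⟩
  simpa using h0.sub hp

lemma boundaryForm_eq_integral_faceRestrict (hle : lo ≤ hi) {χ φ ψ : (Fin (n + 1) → ℝ) → ℝ}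
    (hχ : ContDiff ℝ ∞ χ) (hφ : ContDiff ℝ ∞ φ) (hψ : ContDiff ℝ ∞ ψ) :
    boundaryForm lo hi i χ φ (partialDeriv i φ) ψ (partialDeriv i ψ) =
      weightedInner (i.removeNth lo) (i.removeNth hi) (faceRestrict i (hi i) χ)
        (faceRestrict i (hi i) φ) (faceRestrict i (hi i) ψ) -
      weightedInner (i.removeNth lo) (i.removeNth hi) (faceRestrict i (lo i) χ)
        (faceRestrict i (lo i) φ) (faceRestrict i (lo i) ψ) := by
  have hsmooth : ContDiff ℝ 1 (χ * φ * ψ) :=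
    ((hχ.of_le (by simp)).mul (hφ.of_le (by simp))).mul (hψ.of_le (by simp))
  rw [boundaryForm_contDiff hχ hφ hψ, integral_partialDeriv hle i hsmooth]
  rfl

lemma H1Tendsto.tendsto_faceInner (hle : lo ≤ hi) (hχ : ContDiff ℝ ∞ χ)
    (hp : H1Tendsto (box lo hi) φ p P) (hq : H1Tendsto (box lo hi) ψ q Q) :
    Tendsto (fun k => weightedInner (i.removeNth lo) (i.removeNth hi) (faceRestrict i (hi i) χ)
        (faceRestrict i (hi i) (φ k)) (faceRestrict i (hi i) (ψ k)) -
      weightedInner (i.removeNth lo) (i.removeNth hi) (faceRestrict i (lo i) χ)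
        (faceRestrict i (lo i) (φ k)) (faceRestrict i (lo i) (ψ k))) atTop
      (𝓝 (boundaryForm lo hi i χ p (P i) q (Q i))) := by
  refine (hp.tendsto.boundaryForm hχ (hp.tendsto_partialDeriv i) hq.tendsto
    (hq.tendsto_partialDeriv i)).congr fun k => ?_
  exact boundaryForm_eq_integral_faceRestrict hle hχ (hp.contDiff k) (hq.contDiff k)

lemma faceRestrict_eq_zero (h : ∀ x, x i = c → χ x = 0) : faceRestrict i c χ = 0 :=
  funext fun _ => h _ (by simp)

lemma H1Tendsto.boundaryForm_eq_zero (hle : lo ≤ hi) (hp : H1Tendsto (box lo hi) φ p P)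
    (hχ : ContDiff ℝ ∞ χ) (hlo : ∀ x, x i = lo i → χ x = 0) (hhi : ∀ x, x i = hi i → χ x = 0) :
    boundaryForm lo hi i χ p (P i) 1 0 = 0 := by
  refine tendsto_nhds_unique (hp.tendsto_faceInner hle hχ .one) ?_
  simp [faceRestrict_eq_zero hlo, faceRestrict_eq_zero hhi]

lemma HasTrace.weakZeroTrace (hle : lo ≤ hi) (hp : HasTrace lo hi i c p P 0) :
    WeakZeroTrace lo hi i c p (P i) := by
  intro ψ hψ
  obtain ⟨φ, hφ, hφc⟩ := hp
  have face {d : ℝ} (hd : d = lo i ∨ d = hi i) :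
      Tendsto (fun k => weightedInner (i.removeNth lo) (i.removeNth hi) (faceRestrict i d ψ)
        (faceRestrict i d (φ k)) (faceRestrict i d 1)) atTop (𝓝 0) := by
    rcases eq_or_ne d c with rfl | hdc
    · have restrict_one : faceRestrict i d 1 = fun _ => 1 := rfl
      simpa [restrict_one] using hφc.weightedInner
        (continuous_faceRestrict i d hψ.contDiff.continuous) (.const (memLp_const 1))
    · simp [faceRestrict_eq_zero fun x (hx : x i = d) => hψ.eq_zero x (hx ▸ hd) (hx ▸ hdc)]
  refine tendsto_nhds_unique (hφ.tendsto_faceInner hle hψ.contDiff .one) ?_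
  simpa using (face (.inr rfl)).sub (face (.inl rfl))

lemma WeakZeroTrace.boundaryForm_eq_zero (h : WeakZeroTrace lo hi i c p p')
    (hp : MemLp p 2 (volume.restrict (box lo hi))) (hp' : MemLp p' 2 (volume.restrict (box lo hi)))
    (hq : H1Tendsto (box lo hi) ψ q Q) (hχ : FaceTest lo hi i c χ) :
    boundaryForm lo hi i χ p p' q (Q i) = 0 := by
  refine tendsto_nhds_unique ((L2Tendsto.const hp).boundaryForm hχ.contDiff (.const hp')
    hq.tendsto (hq.tendsto_partialDeriv i)) (tendsto_const_nhds.congr fun k => ?_)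
  rw [boundaryForm_contDiff_right hχ.contDiff (hq.contDiff k) hp hp',
    h _ (hχ.mul_right (hq.contDiff k))]

lemma H1Tendsto.boundaryForm_self_nonpos (hle : lo ≤ hi) (hq : H1Tendsto (box lo hi) ψ q Q)
    (hχ : ContDiff ℝ ∞ χ) (hhi : ∀ x, x i = hi i → χ x = 0) (hpos : ∀ x ∈ Set.Icc lo hi, 0 ≤ χ x) :
    boundaryForm lo hi i χ q (Q i) q (Q i) ≤ 0 := by
  refine le_of_tendsto' (hq.tendsto_faceInner hle hχ hq) fun k => ?_
  rw [faceRestrict_eq_zero hhi, weightedInner_zero_weight, zero_sub, neg_nonpos]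
  exact weightedInner_self_nonneg fun y hy => hpos _
    (Fin.insertNth_mem_Icc.2 ⟨⟨le_rfl, hle i⟩, box_subset_Icc hy⟩)

end Traces

/-! ### Vanishing of tangential derivatives -/

lemma exists_cutoff (a b : ℝ) : ∃ η : ℕ → ℝ → ℝ, (∀ k, ContDiff ℝ ∞ (η k)) ∧
    (∀ k, η k a = 0 ∧ η k b = 0) ∧ (∀ k s, |η k s| ≤ 1) ∧
    ∀ s ∈ Set.Ioo a b, Tendsto (fun k => η k s) atTop (𝓝 1) := by
  have tendsto_one {r : ℝ} (hr : 0 < r) :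
      Tendsto (fun k : ℕ => Real.smoothTransition (k * r)) atTop (𝓝 1) := by
    have h := (tendsto_natCast_atTop_atTop (R := ℝ)).atTop_mul_const hr
    refine tendsto_const_nhds.congr' ?_
    filter_upwards [h.eventually_ge_atTop 1] with k hk
    exact (Real.smoothTransition.one_of_one_le hk).symm
  refine ⟨fun k s => Real.smoothTransition (k * (s - a)) * Real.smoothTransition (k * (b - s)),
    fun k => ?_, fun k => by simp, fun k s => ?_, fun s hs => ?_⟩
  · exact (Real.smoothTransition.contDiff.comp (by fun_prop)).mul
      (Real.smoothTransition.contDiff.comp (by fun_prop))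
  · rw [abs_of_nonneg (mul_nonneg (Real.smoothTransition.nonneg _)
      (Real.smoothTransition.nonneg _))]
    exact mul_le_one₀ (Real.smoothTransition.le_one _) (Real.smoothTransition.nonneg _)
      (Real.smoothTransition.le_one _)
  · simpa using (tendsto_one (sub_pos.2 hs.1)).mul (tendsto_one (sub_pos.2 hs.2))

lemma integral_box_eq_zero_of_forall_cutoff {n : ℕ} {lo hi : Fin n → ℝ} (j : Fin n)
    {f : (Fin n → ℝ) → ℝ} (hf : Integrable f (volume.restrict (box lo hi)))
    (h : ∀ η : ℝ → ℝ, ContDiff ℝ ∞ η → η (lo j) = 0 → η (hi j) = 0 →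
      ∫ x in box lo hi, η (x j) * f x = 0) :
    ∫ x in box lo hi, f x = 0 := by
  obtain ⟨η, hη, hη0, hη1, hlim⟩ := exists_cutoff (lo j) (hi j)
  have hmeas (k : ℕ) : AEStronglyMeasurable (fun x : Fin n → ℝ => η k (x j))
      (volume.restrict (box lo hi)) :=
    ((hη k).continuous.comp (continuous_apply j)).aestronglyMeasurable
  refine tendsto_nhds_unique (tendsto_integral_of_dominated_convergence (fun x => ‖f x‖)
    (fun k => (hmeas k).mul hf.1) hf.norm (fun k => ae_of_all _ fun x => ?_)
    (ae_restrict_box fun x hx => ?_))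
    (tendsto_const_nhds.congr fun k => (h (η k) (hη k) (hη0 k).1 (hη0 k).2).symm)
  · rw [Pi.mul_apply, norm_mul]
    exact mul_le_of_le_one_left (norm_nonneg _) (hη1 k _)
  · simpa using (hlim (x j) (hx j)).mul_const (f x)

section Tangential

variable {n : ℕ} {lo hi : Fin (n + 1) → ℝ} {i j : Fin (n + 1)} {c : ℝ}
  {p ψ : (Fin (n + 1) → ℝ) → ℝ} {P Q : Fin (n + 1) → (Fin (n + 1) → ℝ) → ℝ}
  {φ : ℕ → (Fin (n + 1) → ℝ) → ℝ}

/-- Integrating by parts twice moves `∂ⱼ` onto the test function, after which `p` enters only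
through its trace on `xᵢ = c`. -/
lemma HasTrace.boundaryForm_tangential_eq_zero (hle : lo ≤ hi) (hij : i ≠ j)
    (hp : HasTrace lo hi i c p P 0) (hPi : H1Tendsto (box lo hi) φ (P i) Q)
    (hψ : FaceTest lo hi i c ψ) (hlo : ∀ x, x j = lo j → ψ x = 0)
    (hhi : ∀ x, x j = hi j → ψ x = 0) :
    boundaryForm lo hi i ψ (P j) (Q j) 1 0 = 0 := by
  have hp_weak := hp.weakZeroTrace hle
  obtain ⟨ξ, hξ, -⟩ := hp
  have hψd : Differentiable ℝ ψ := hψ.contDiff.differentiable (by simp)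
  have hp_j : boundaryForm lo hi j (partialDeriv i ψ) p (P j) 1 0 = 0 :=
    hξ.boundaryForm_eq_zero hle (contDiff_partialDeriv i hψ.contDiff)
      (fun _ => partialDeriv_eq_zero_of_hyperplane hij hψd hlo)
      (fun _ => partialDeriv_eq_zero_of_hyperplane hij hψd hhi)
  have hp_i : boundaryForm lo hi i (partialDeriv j ψ) p (P i) 1 0 = 0 :=
    hp_weak _ (hψ.partialDeriv hij.symm)
  have hPi_j : boundaryForm lo hi j ψ (P i) (Q j) 1 0 = 0 :=
    hPi.boundaryForm_eq_zero hle hψ.contDiff hlo hhi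
  simp only [boundaryForm, weightedInner_zero_right, add_zero] at hp_j hp_i hPi_j ⊢
  rw [partialDeriv_comm i j (hψ.contDiff.of_le ENat.LEInfty.out)] at hp_i
  linear_combination hp_j - hp_i + hPi_j

/-- The test function is first cut off near the faces `xⱼ = lo j` and `xⱼ = hi j`, by a factor
independent of `xᵢ`. -/
lemma HasTrace.weakZeroTrace_tangential (hle : lo ≤ hi) (hij : i ≠ j)
    (hp : HasTrace lo hi i c p P 0) (hPi : H1Tendsto (box lo hi) φ (P i) Q) :
    WeakZeroTrace lo hi i c (P j) (Q j) := by
  intro ψ hψ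
  have hPj : MemLp (P j) 2 (volume.restrict (box lo hi)) :=
    hp.elim fun _ hξ => hξ.1.memLp_deriv j
  have hQj := hPi.memLp_deriv j
  have hone : MemLp (1 : (Fin (n + 1) → ℝ) → ℝ) 2 (volume.restrict (box lo hi)) := memLp_const 1
  rw [boundaryForm_eq_integral hψ.contDiff hPj hQj hone MemLp.zero]
  refine integral_box_eq_zero_of_forall_cutoff j
    (integrable_boundaryForm hψ.contDiff hPj hQj hone MemLp.zero) fun η hη hηlo hηhi => ?_
  let ηj : (Fin (n + 1) → ℝ) → ℝ := fun x => η (x j)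
  have hηj : ContDiff ℝ ∞ ηj := hη.comp (contDiff_apply ℝ ℝ j)
  have hηi : partialDeriv i ηj = 0 := funext fun x =>
    partialDeriv_eq_zero_of_line (hηj.differentiable (by simp)) fun s => by simp [ηj, hij.symm]
  have htest : FaceTest lo hi i c (ψ * ηj) := hψ.mul_right hηj
  have h := hp.boundaryForm_tangential_eq_zero hle hij hPi htest
    (fun x hx => by simp [ηj, hx, hηlo]) (fun x hx => by simp [ηj, hx, hηhi])
  rw [boundaryForm_eq_integral htest.contDiff hPj hQj hone MemLp.zero,
    partialDeriv_mul i (hψ.contDiff.differentiable (by simp)) (hηj.differentiable (by simp)),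
    hηi] at h
  rw [← h]
  refine congrArg (fun f : (Fin (n + 1) → ℝ) → ℝ => ∫ x in box lo hi, f x) ?_
  change ηj * _ = _
  ring

end Tangential

/-! ### Boundary conditions that do not increase the energy -/

/-- The boundary integral of `p q νᵢ` over the face `xᵢ = c`, with any nonnegative weight, is at
most zero, in the weak sense; `p'` and `q'` are the partial derivatives in direction `i`. With `p`
the derivative in direction `i` and `q` the time derivative of a solution of the wave equation, this
says that no energy enters through the face. -/
def NonposFlux {n : ℕ} (lo hi : Fin n → ℝ) (i : Fin n) (c : ℝ) (p p' q q' : (Fin n → ℝ) → ℝ) :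
    Prop :=
  ∀ χ, FaceTest lo hi i c χ → (∀ x ∈ Set.Icc lo hi, 0 ≤ χ x) →
    boundaryForm lo hi i χ p p' q q' ≤ 0

section NonposFlux

variable {n : ℕ} {lo hi : Fin (n + 1) → ℝ} {i : Fin (n + 1)} {c : ℝ}
  {p p' q q' θ : (Fin (n + 1) → ℝ) → ℝ} {P Q : Fin (n + 1) → (Fin (n + 1) → ℝ) → ℝ}
  {φ ψ : ℕ → (Fin (n + 1) → ℝ) → ℝ}

lemma WeakZeroTrace.nonposFlux_left (h : WeakZeroTrace lo hi i c p p')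
    (hp : MemLp p 2 (volume.restrict (box lo hi))) (hp' : MemLp p' 2 (volume.restrict (box lo hi)))
    (hq : H1Tendsto (box lo hi) ψ q Q) : NonposFlux lo hi i c p p' q (Q i) :=
  fun _ hχ _ => (h.boundaryForm_eq_zero hp hp' hq hχ).le

lemma WeakZeroTrace.nonposFlux_right (h : WeakZeroTrace lo hi i c q q')
    (hq : MemLp q 2 (volume.restrict (box lo hi))) (hq' : MemLp q' 2 (volume.restrict (box lo hi)))
    (hp : H1Tendsto (box lo hi) φ p P) : NonposFlux lo hi i c p (P i) q q' := fun χ hχ hpos => by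
  rw [boundaryForm_comm]
  exact h.nonposFlux_left hq hq' hp χ hχ hpos

lemma WeakZeroTrace.nonposFlux_of_sub (hle : lo ≤ hi) (hlt : lo i < hi i)
    (h : WeakZeroTrace lo hi i (lo i) (q - p) (Q i - P i)) (hp : H1Tendsto (box lo hi) φ p P)
    (hq : H1Tendsto (box lo hi) ψ q Q) : NonposFlux lo hi i (lo i) p (P i) q (Q i) := by
  intro χ hχ hpos
  have hsub := h.boundaryForm_eq_zero (hq.memLp.sub hp.memLp)
    ((hq.memLp_deriv i).sub (hp.memLp_deriv i)) hq hχ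
  rw [boundaryForm_sub_left hχ.contDiff hq.memLp (hq.memLp_deriv i) hq.memLp (hq.memLp_deriv i)
    hp.memLp (hp.memLp_deriv i), sub_eq_zero] at hsub
  rw [← hsub]
  exact hq.boundaryForm_self_nonpos hle hχ.contDiff
    (fun x hx => hχ.eq_zero x (.inr hx) (hx ▸ hlt.ne')) hpos

lemma boundaryForm_nonpos_of_nonposFlux (hlt : lo i < hi i)
    (hlo : NonposFlux lo hi i (lo i) p p' q q') (hhi : NonposFlux lo hi i (hi i) p p' q q')
    (hp : MemLp p 2 (volume.restrict (box lo hi))) (hp' : MemLp p' 2 (volume.restrict (box lo hi)))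
    (hq : MemLp q 2 (volume.restrict (box lo hi))) (hq' : MemLp q' 2 (volume.restrict (box lo hi)))
    (hθ : ContDiff ℝ ∞ θ) (hpos : ∀ x ∈ Set.Icc lo hi, 0 ≤ θ x) :
    boundaryForm lo hi i θ p p' q q' ≤ 0 := by
  let θlo : (Fin (n + 1) → ℝ) → ℝ := fun x => θ x * ((hi i - x i) / (hi i - lo i))
  let θhi : (Fin (n + 1) → ℝ) → ℝ := fun x => θ x * ((x i - lo i) / (hi i - lo i))
  have hlen : 0 < hi i - lo i := sub_pos.2 hlt
  have hθlo : ContDiff ℝ ∞ θlo := hθ.mul (by fun_prop)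
  have hθhi : ContDiff ℝ ∞ θhi := hθ.mul (by fun_prop)
  have hsplit : θ = θlo + θhi := by
    funext x
    simp only [θlo, θhi, Pi.add_apply]
    field_simp
    ring
  have flux_lo : boundaryForm lo hi i θlo p p' q q' ≤ 0 :=
    hlo θlo ⟨hθlo, fun x hx hne => by simp [θlo, hx.resolve_left hne]⟩ fun x hx =>
      mul_nonneg (hpos x hx) (div_nonneg (sub_nonneg.2 (hx.2 i)) hlen.le)
  have flux_hi : boundaryForm lo hi i θhi p p' q q' ≤ 0 :=
    hhi θhi ⟨hθhi, fun x hx hne => by simp [θhi, hx.resolve_right hne]⟩ fun x hx =>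
      mul_nonneg (hpos x hx) (div_nonneg (sub_nonneg.2 (hx.1 i)) hlen.le)
  rw [hsplit, boundaryForm_add_weight hθlo hp hp' hq hq' hθhi]
  exact add_nonpos flux_lo flux_hi

end NonposFlux

/-! ### The energy estimate -/

/-- The weight `hi t - xₜ`: the energy identity arises by multiplying the wave equation by it and by
the time derivative. -/
def timeWeight {n : ℕ} (hi : Fin n → ℝ) (t : Fin n) : (Fin n → ℝ) → ℝ := fun x => hi t - x t

lemma l2NormSq_nonneg {n : ℕ} (Ω : Set (Fin n → ℝ)) (u : (Fin n → ℝ) → ℝ) : 0 ≤ l2NormSq Ω u :=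
  integral_nonneg fun _ => sq_nonneg _

section TimeWeight

variable {n : ℕ} {lo hi : Fin n → ℝ} {t : Fin n}

lemma contDiff_timeWeight : ContDiff ℝ ∞ (timeWeight hi t) := by
  unfold timeWeight
  fun_prop

lemma timeWeight_nonneg {x : Fin n → ℝ} (hx : x ∈ Set.Icc lo hi) : 0 ≤ timeWeight hi t x :=
  sub_nonneg.2 (hx.2 t)

lemma timeWeight_le {x : Fin n → ℝ} (hx : x ∈ Set.Icc lo hi) : timeWeight hi t x ≤ hi t - lo t :=
  sub_le_sub_left (hx.1 t) _

lemma faceTest_timeWeight : FaceTest lo hi t (lo t) (timeWeight hi t) where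
  contDiff := contDiff_timeWeight
  eq_zero x hx hne := by simp [timeWeight, hx.resolve_left hne]

lemma partialDeriv_timeWeight_self : partialDeriv t (timeWeight hi t) = -1 :=
  (partialDeriv_const_sub_apply t t (hi t)).trans (by ext; simp)

lemma partialDeriv_timeWeight_of_ne {i : Fin n} (hit : i ≠ t) :
    partialDeriv i (timeWeight hi t) = 0 :=
  (partialDeriv_const_sub_apply i t (hi t)).trans (by ext; simp [hit.symm])

lemma weightedInner_partialDeriv_timeWeight (f : (Fin n → ℝ) → ℝ) :
    weightedInner lo hi (partialDeriv t (timeWeight hi t)) f f = -l2NormSq (box lo hi) f := by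
  rw [partialDeriv_timeWeight_self, weightedInner, l2NormSq, ← integral_neg]
  refine integral_congr_ae (ae_of_all _ fun x => ?_)
  simp only [Pi.neg_apply, Pi.one_apply]
  ring

lemma two_mul_weightedInner_timeWeight_le {f g : (Fin n → ℝ) → ℝ}
    (hf : MemLp f 2 (volume.restrict (box lo hi))) (hg : MemLp g 2 (volume.restrict (box lo hi))) :
    2 * weightedInner lo hi (timeWeight hi t) f g ≤
      2 * (hi t - lo t) ^ 2 * l2NormSq (box lo hi) f + 1 / 2 * l2NormSq (box lo hi) g := by
  have hf' := hf.integrable_sq.const_mul (2 * (hi t - lo t) ^ 2)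
  have hg' := hg.integrable_sq.const_mul (1 / 2)
  rw [weightedInner, l2NormSq, l2NormSq, ← integral_const_mul, ← integral_const_mul,
    ← integral_const_mul, ← integral_add hf' hg']
  refine integral_mono_ae ((integrable_continuous_mul_mul contDiff_timeWeight.continuous hf
    hg).const_mul 2) (hf'.add hg') (ae_restrict_box fun x hx => ?_)
  have hx' := box_subset_Icc hx
  have hsq : timeWeight hi t x ^ 2 * f x ^ 2 ≤ (hi t - lo t) ^ 2 * f x ^ 2 := by
    gcongr
    exacts [timeWeight_nonneg hx', timeWeight_le hx']
  linarith [two_mul_le_add_sq (2 * (timeWeight hi t x * f x)) (g x)]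

end TimeWeight

section TimeTrace

variable {n : ℕ} {lo hi : Fin (n + 1) → ℝ} {t : Fin (n + 1)} {p p' : (Fin (n + 1) → ℝ) → ℝ}
  {P : Fin (n + 1) → (Fin (n + 1) → ℝ) → ℝ} {φ : ℕ → (Fin (n + 1) → ℝ) → ℝ}

lemma WeakZeroTrace.l2NormSq_eq (h : WeakZeroTrace lo hi t (lo t) p p')
    (hp : H1Tendsto (box lo hi) φ p P) (hP : P t =ᵐ[volume.restrict (box lo hi)] p') :
    l2NormSq (box lo hi) p = 2 * weightedInner lo hi (timeWeight hi t) p' p := by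
  have hp' := (hp.memLp_deriv t).ae_eq hP
  have hzero := h.boundaryForm_eq_zero hp.memLp hp' hp faceTest_timeWeight
  rw [boundaryForm, weightedInner_partialDeriv_timeWeight,
    weightedInner_comm _ p, weightedInner_congr _ hP (ae_eq_refl p)] at hzero
  linarith

/-- Poincaré's inequality, with the constant coming from the weight `hi t - xₜ`. -/
lemma WeakZeroTrace.l2NormSq_le (h : WeakZeroTrace lo hi t (lo t) p (P t))
    (hp : H1Tendsto (box lo hi) φ p P) :
    l2NormSq (box lo hi) p ≤ 4 * (hi t - lo t) ^ 2 * l2NormSq (box lo hi) (P t) := by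
  have hinner := two_mul_weightedInner_timeWeight_le (t := t) (hp.memLp_deriv t) hp.memLp
  rw [← h.l2NormSq_eq hp (ae_eq_refl _)] at hinner
  linarith

end TimeTrace

/-- The wave operator `∂ₜ² - ∑ᵢ ∂ᵢ²` (sum over `i ≠ t`) applied to a function with Hessian `H`. -/
def waveOperator {n : ℕ} (t : Fin n) (H : Fin n → Fin n → (Fin n → ℝ) → ℝ) : (Fin n → ℝ) → ℝ :=
  H t t - ∑ i ∈ {t}ᶜ, H i i

lemma waveOperator_sub {n : ℕ} (t : Fin n) (H K : Fin n → Fin n → (Fin n → ℝ) → ℝ) :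
    waveOperator t (H - K) = waveOperator t H - waveOperator t K := by
  simp only [waveOperator, Pi.sub_apply, Finset.sum_sub_distrib]
  abel

lemma memLp_waveOperator {n : ℕ} {t : Fin n} {μ : Measure (Fin n → ℝ)}
    {H : Fin n → Fin n → (Fin n → ℝ) → ℝ} (hH : ∀ i, MemLp (H i i) 2 μ) :
    MemLp (waveOperator t H) 2 μ :=
  (hH t).sub (memLp_finsetSum' _ fun i _ => hH i)

lemma weightedInner_waveOperator {n : ℕ} {lo hi : Fin n → ℝ} {t : Fin n}
    {χ g : (Fin n → ℝ) → ℝ} {H : Fin n → Fin n → (Fin n → ℝ) → ℝ} (hχ : Continuous χ)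
    (hH : ∀ i, MemLp (H i i) 2 (volume.restrict (box lo hi)))
    (hg : MemLp g 2 (volume.restrict (box lo hi))) :
    weightedInner lo hi χ (waveOperator t H) g =
      weightedInner lo hi χ (H t t) g - ∑ i ∈ {t}ᶜ, weightedInner lo hi χ (H i i) g := by
  rw [waveOperator, weightedInner_sub_left hχ (hH t) (memLp_finsetSum' _ fun i _ => hH i) hg,
    weightedInner_sum_left hχ (fun i _ => hH i) hg]

/-- `w`, with gradient `W` and Hessian `H`, satisfies the initial and boundary conditions of the
problem on a box with time direction `t`: zero Cauchy data at `xₜ = lo t`, Dirichlet data `d` on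
`xₘ = hi m`, the absorbing condition on `xₘ = lo m` and Neumann conditions on the other faces. -/
structure MixedConditions {n : ℕ} (lo hi : Fin (n + 1) → ℝ) (t m : Fin (n + 1))
    (d : (Fin n → ℝ) → ℝ) (w : (Fin (n + 1) → ℝ) → ℝ) (W : Fin (n + 1) → (Fin (n + 1) → ℝ) → ℝ)
    (H : Fin (n + 1) → Fin (n + 1) → (Fin (n + 1) → ℝ) → ℝ) : Prop where
  symm : ∀ i j, H i j =ᵐ[volume.restrict (box lo hi)] H j i
  initial : HasTrace lo hi t (lo t) w W 0
  initial_deriv : HasTrace lo hi t (lo t) (W t) (H t) 0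
  dirichlet : HasTrace lo hi m (hi m) w W d
  absorbing : HasTrace lo hi m (lo m) (W t - W m) (H t - H m) 0
  neumann_lo : ∀ i, i ≠ t → i ≠ m → HasTrace lo hi i (lo i) (W i) (H i) 0
  neumann_hi : ∀ i, i ≠ t → i ≠ m → HasTrace lo hi i (hi i) (W i) (H i) 0

namespace MixedConditions

variable {n : ℕ} {lo hi : Fin (n + 1) → ℝ} {t m i : Fin (n + 1)} {d d' : (Fin n → ℝ) → ℝ}
  {w v : (Fin (n + 1) → ℝ) → ℝ} {W V : Fin (n + 1) → (Fin (n + 1) → ℝ) → ℝ}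
  {H K : Fin (n + 1) → Fin (n + 1) → (Fin (n + 1) → ℝ) → ℝ}

lemma sub (hw : MixedConditions lo hi t m d w W H) (hv : MixedConditions lo hi t m d' v V K) :
    MixedConditions lo hi t m (d - d') (w - v) (W - V) (H - K) where
  symm i j := (hw.symm i j).sub (hv.symm i j)
  initial := by simpa using hw.initial.sub hv.initial
  initial_deriv := by simpa using hw.initial_deriv.sub hv.initial_deriv
  dirichlet := hw.dirichlet.sub hv.dirichlet
  absorbing := by
    simpa [sub_sub_sub_comm] using hw.absorbing.sub hv.absorbing
  neumann_lo i ht hm := by simpa using (hw.neumann_lo i ht hm).sub (hv.neumann_lo i ht hm)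
  neumann_hi i ht hm := by simpa using (hw.neumann_hi i ht hm).sub (hv.neumann_hi i ht hm)

lemma exists_h1Tendsto (hw : MixedConditions lo hi t m d w W H) (i : Fin (n + 1)) :
    ∃ φ, H1Tendsto (box lo hi) φ (W i) (H i) := by
  obtain ⟨φ, hφ, -⟩ := hw.initial_deriv
  by_cases hit : i = t
  · exact hit ▸ ⟨φ, hφ⟩
  by_cases him : i = m
  · obtain ⟨ψ, hψ, -⟩ := hw.absorbing
    exact him ▸ ⟨_, by simpa using hφ.sub hψ⟩
  · exact (hw.neumann_lo i hit him).imp fun _ h => h.1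

lemma memLp_grad (hw : MixedConditions lo hi t m d w W H) (i : Fin (n + 1)) :
    MemLp (W i) 2 (volume.restrict (box lo hi)) :=
  (hw.exists_h1Tendsto i).elim fun _ h => h.memLp

lemma memLp_hess (hw : MixedConditions lo hi t m d w W H) (i j : Fin (n + 1)) :
    MemLp (H i j) 2 (volume.restrict (box lo hi)) :=
  (hw.exists_h1Tendsto i).elim fun _ h => h.memLp_deriv j

lemma weakZeroTrace_grad_initial (hw : MixedConditions lo hi t m d w W H) (hle : lo ≤ hi)
    (i : Fin (n + 1)) : WeakZeroTrace lo hi t (lo t) (W i) (H t i) := by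
  obtain ⟨φ, hφ⟩ := hw.exists_h1Tendsto t
  rcases eq_or_ne t i with rfl | hti
  · exact hw.initial_deriv.weakZeroTrace hle
  · exact hw.initial.weakZeroTrace_tangential hle hti hφ

lemma weakZeroTrace_dirichlet (hw : MixedConditions lo hi t m 0 w W H) (hle : lo ≤ hi)
    (hmt : m ≠ t) : WeakZeroTrace lo hi m (hi m) (W t) (H t m) := by
  obtain ⟨φ, hφ⟩ := hw.exists_h1Tendsto m
  intro ψ hψ
  rw [boundaryForm_congr_deriv (hw.symm t m)]
  exact hw.dirichlet.weakZeroTrace_tangential hle hmt hφ ψ hψ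

lemma nonposFlux_lo (hw : MixedConditions lo hi t m d w W H) (hlt : ∀ i, lo i < hi i)
    (hit : i ≠ t) : NonposFlux lo hi i (lo i) (W i) (H i i) (W t) (H t i) := by
  have hle : lo ≤ hi := fun i => (hlt i).le
  obtain ⟨φ, hφ⟩ := hw.exists_h1Tendsto i
  obtain ⟨ψ, hψ⟩ := hw.exists_h1Tendsto t
  rcases eq_or_ne i m with rfl | him
  · exact (hw.absorbing.weakZeroTrace hle).nonposFlux_of_sub hle (hlt i) hφ hψ
  · exact ((hw.neumann_lo i hit him).weakZeroTrace hle).nonposFlux_left hφ.memLp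
      (hφ.memLp_deriv i) hψ

lemma nonposFlux_hi (hw : MixedConditions lo hi t m 0 w W H) (hle : lo ≤ hi) (hit : i ≠ t) :
    NonposFlux lo hi i (hi i) (W i) (H i i) (W t) (H t i) := by
  obtain ⟨φ, hφ⟩ := hw.exists_h1Tendsto i
  obtain ⟨ψ, hψ⟩ := hw.exists_h1Tendsto t
  rcases eq_or_ne i m with rfl | him
  · exact (hw.weakZeroTrace_dirichlet hle hit).nonposFlux_right hψ.memLp (hψ.memLp_deriv i) hφ
  · exact ((hw.neumann_hi i hit him).weakZeroTrace hle).nonposFlux_left hφ.memLp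
      (hφ.memLp_deriv i) hψ

/-- The weight does not depend on `xᵢ`, so the boundary form consists of these two terms only. -/
lemma weightedInner_add_nonpos (hw : MixedConditions lo hi t m 0 w W H)
    (hlt : ∀ i, lo i < hi i) (hit : i ≠ t) :
    weightedInner lo hi (timeWeight hi t) (H i i) (W t) +
      weightedInner lo hi (timeWeight hi t) (W i) (H t i) ≤ 0 := by
  have h := boundaryForm_nonpos_of_nonposFlux (hlt i) (hw.nonposFlux_lo hlt hit)
    (hw.nonposFlux_hi (fun i => (hlt i).le) hit) (hw.memLp_grad i) (hw.memLp_hess i i)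
    (hw.memLp_grad t) (hw.memLp_hess t i) (contDiff_timeWeight (t := t)) fun x => timeWeight_nonneg
  simpa [boundaryForm, partialDeriv_timeWeight_of_ne hit] using h

lemma l2NormSq_grad_eq (hw : MixedConditions lo hi t m d w W H) (hle : lo ≤ hi)
    (i : Fin (n + 1)) :
    l2NormSq (box lo hi) (W i) = 2 * weightedInner lo hi (timeWeight hi t) (H t i) (W i) :=
  (hw.exists_h1Tendsto i).elim fun _ h =>
    (hw.weakZeroTrace_grad_initial hle i).l2NormSq_eq h (hw.symm i t)

lemma sum_l2NormSq_grad_le_weightedInner (hw : MixedConditions lo hi t m 0 w W H)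
    (hlt : ∀ i, lo i < hi i) :
    ∑ i, l2NormSq (box lo hi) (W i) ≤
      2 * weightedInner lo hi (timeWeight hi t) (waveOperator t H) (W t) := by
  have hle : lo ≤ hi := fun i => (hlt i).le
  rw [weightedInner_waveOperator contDiff_timeWeight.continuous (fun i => hw.memLp_hess i i)
      (hw.memLp_grad t), Fintype.sum_eq_add_sum_compl t, hw.l2NormSq_grad_eq hle t, mul_sub,
    sub_eq_add_neg, ← mul_neg, ← Finset.sum_neg_distrib, Finset.mul_sum]
  gcongr with i hi_mem
  rw [hw.l2NormSq_grad_eq hle i, weightedInner_comm]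
  linarith [hw.weightedInner_add_nonpos hlt (by simpa using hi_mem)]

lemma sum_l2NormSq_grad_le (hw : MixedConditions lo hi t m 0 w W H) (hlt : ∀ i, lo i < hi i) :
    ∑ i, l2NormSq (box lo hi) (W i) ≤
      4 * (hi t - lo t) ^ 2 * l2NormSq (box lo hi) (waveOperator t H) := by
  have hwave := hw.sum_l2NormSq_grad_le_weightedInner hlt
  have hinner := two_mul_weightedInner_timeWeight_le (t := t)
    (memLp_waveOperator (t := t) fun i => hw.memLp_hess i i) (hw.memLp_grad t)
  have htime : l2NormSq (box lo hi) (W t) ≤ ∑ i, l2NormSq (box lo hi) (W i) :=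
    Finset.single_le_sum (fun i _ => l2NormSq_nonneg _ (W i)) (Finset.mem_univ t)
  linarith

theorem energy_le (hw : MixedConditions lo hi t m 0 w W H) (hlt : ∀ i, lo i < hi i) :
    l2NormSq (box lo hi) w + ∑ i, l2NormSq (box lo hi) (W i) ≤
      4 * (hi t - lo t) ^ 2 * (1 + 4 * (hi t - lo t) ^ 2) *
        l2NormSq (box lo hi) (waveOperator t H) := by
  obtain ⟨φ, hφ, -⟩ := id hw.initial
  have hpoincare := (hw.initial.weakZeroTrace fun i => (hlt i).le).l2NormSq_le hφ
  have hgrad := hw.sum_l2NormSq_grad_le hlt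
  have htime : l2NormSq (box lo hi) (W t) ≤ ∑ i, l2NormSq (box lo hi) (W i) :=
    Finset.single_le_sum (fun i _ => l2NormSq_nonneg _ (W i)) (Finset.mem_univ t)
  calc _ ≤ (1 + 4 * (hi t - lo t) ^ 2) * ∑ i, l2NormSq (box lo hi) (W i) := by
        rw [one_add_mul, add_comm]
        gcongr
        exact hpoincare.trans (by gcongr)
    _ ≤ (1 + 4 * (hi t - lo t) ^ 2) *
        (4 * (hi t - lo t) ^ 2 * l2NormSq (box lo hi) (waveOperator t H)) := by gcongr
    _ = _ := by ring

end MixedConditions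

/-! ### Weak derivatives and Sobolev norms -/

/-- The weak gradient of `u` on `Ω`. -/
def weakGrad {n : ℕ} (Ω : Set (Fin n → ℝ)) (u : (Fin n → ℝ) → ℝ) : Fin n → (Fin n → ℝ) → ℝ :=
  fun i => weakDeriv Ω i u

/-- The weak Hessian of `u` on `Ω`; the first index is that of the derivative taken first. -/
def weakHess {n : ℕ} (Ω : Set (Fin n → ℝ)) (u : (Fin n → ℝ) → ℝ) :
    Fin n → Fin n → (Fin n → ℝ) → ℝ :=
  fun i => weakGrad Ω (weakDeriv Ω i u)

section Sobolev

variable {n k : ℕ} {Ω : Set (Fin n → ℝ)} {i j : Fin n} {u u' v v' φ : (Fin n → ℝ) → ℝ}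
  {V : Fin n → (Fin n → ℝ) → ℝ}

lemma integrable_mul_of_tsupport_subset (hv : LocallyIntegrableOn v Ω volume) (hφ : Continuous φ)
    (hc : HasCompactSupport φ) (hs : tsupport φ ⊆ Ω) :
    Integrable (fun x => v x * φ x) (volume.restrict Ω) := by
  have htsupport : IntegrableOn (fun x => v x * φ x) (tsupport φ) volume :=
    (hv.integrableOn_compact_subset hs hc).mul_continuousOn hφ.continuousOn hc
  refine ((integrableOn_iff_integrable_of_support_subset ?_).1 htsupport).restrict
  exact (Function.support_mul_subset_right _ _).trans (subset_tsupport φ)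

lemma tsupport_partialDeriv_subset (i : Fin n) (φ : (Fin n → ℝ) → ℝ) :
    tsupport (partialDeriv i φ) ⊆ tsupport φ :=
  tsupport_fderiv_apply_subset ℝ _

lemma hasCompactSupport_partialDeriv (i : Fin n) (hc : HasCompactSupport φ) :
    HasCompactSupport (partialDeriv i φ) :=
  hc.fderiv_apply ℝ _

lemma setIntegral_eq_integral_of_tsupport_subset {f : (Fin n → ℝ) → ℝ}
    (hs : tsupport φ ⊆ Ω) : ∫ x in Ω, f x * φ x = ∫ x, f x * φ x :=
  setIntegral_eq_integral_of_forall_compl_eq_zero fun _ hx => by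
    rw [image_eq_zero_of_notMem_tsupport fun h => hx (hs h), mul_zero]

lemma locallyIntegrableOn_of_memLp (hu : MemLp u 2 (volume.restrict Ω)) :
    LocallyIntegrableOn u Ω volume :=
  locallyIntegrableOn_of_locallyIntegrable_restrict (hu.locallyIntegrable one_le_two)

namespace HasWeakDeriv

lemma ae_unique (hΩ : IsOpen Ω) (h : HasWeakDeriv Ω i u v) (h' : HasWeakDeriv Ω i u v') :
    v =ᵐ[volume.restrict Ω] v' := by
  have hzero : ∀ᵐ x, x ∈ Ω → (v - v') x = 0 := by
    refine hΩ.ae_eq_zero_of_integral_contDiff_smul_eq_zero (h.2.1.sub h'.2.1) fun φ hφ hc hs => ?_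
    simp only [smul_eq_mul, mul_comm (φ _), Pi.sub_apply]
    rw [← setIntegral_eq_integral_of_tsupport_subset (f := fun x => v x - v' x) hs]
    simp only [sub_mul]
    rw [integral_sub (integrable_mul_of_tsupport_subset h.2.1 hφ.continuous hc hs)
      (integrable_mul_of_tsupport_subset h'.2.1 hφ.continuous hc hs), sub_eq_zero]
    exact neg_injective ((h.2.2 φ hφ hc hs).symm.trans (h'.2.2 φ hφ hc hs))
  rw [EventuallyEq, ae_restrict_iff' hΩ.measurableSet]
  exact hzero.mono fun x hx hxΩ => sub_eq_zero.1 (hx hxΩ)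

lemma sub (h : HasWeakDeriv Ω i u v) (h' : HasWeakDeriv Ω i u' v') :
    HasWeakDeriv Ω i (u - u') (v - v') := by
  refine ⟨h.1.sub h'.1, h.2.1.sub h'.2.1, fun φ hφ hc hs => ?_⟩
  have hφ' := (contDiff_partialDeriv i hφ).continuous
  have hc' := hasCompactSupport_partialDeriv i hc
  have hs' := (tsupport_partialDeriv_subset i φ).trans hs
  have hu : ∫ x in Ω, (u x - u' x) * partialDeriv i φ x =
      (∫ x in Ω, u x * partialDeriv i φ x) - ∫ x in Ω, u' x * partialDeriv i φ x := by
    simpa only [sub_mul] using integral_sub (integrable_mul_of_tsupport_subset h.1 hφ' hc' hs')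
      (integrable_mul_of_tsupport_subset h'.1 hφ' hc' hs')
  have hv : ∫ x in Ω, (v x - v' x) * φ x = (∫ x in Ω, v x * φ x) - ∫ x in Ω, v' x * φ x := by
    simpa only [sub_mul] using integral_sub
      (integrable_mul_of_tsupport_subset h.2.1 hφ.continuous hc hs)
      (integrable_mul_of_tsupport_subset h'.2.1 hφ.continuous hc hs)
  calc _ = (∫ x in Ω, u x * partialDeriv i φ x) - ∫ x in Ω, u' x * partialDeriv i φ x := hu
    _ = (-∫ x in Ω, v x * φ x) - -∫ x in Ω, v' x * φ x :=
        congrArg₂ (· - ·) (h.2.2 φ hφ hc hs) (h'.2.2 φ hφ hc hs)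
    _ = -∫ x in Ω, (v x - v' x) * φ x := by rw [hv]; ring

lemma neg (h : HasWeakDeriv Ω i u v) : HasWeakDeriv Ω i (-u) (-v) :=
  ⟨h.1.neg, h.2.1.neg, fun φ hφ hc hs => by
    simp only [Pi.neg_apply, neg_mul, integral_neg, h.2.2 φ hφ hc hs]⟩

lemma congr (h : HasWeakDeriv Ω i u v) (hu' : LocallyIntegrableOn u' Ω volume)
    (huu' : u =ᵐ[volume.restrict Ω] u') : HasWeakDeriv Ω i u' v := by
  refine ⟨hu', h.2.1, fun φ hφ hc hs => (integral_congr_ae ?_).trans (h.2.2 φ hφ hc hs)⟩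
  filter_upwards [huu'] with x hx
  rw [hx]

lemma of_contDiff (hu : ContDiff ℝ ∞ u) : HasWeakDeriv Ω i u (partialDeriv i u) := by
  have hu' := (contDiff_partialDeriv i hu).continuous
  refine ⟨hu.continuous.locallyIntegrable.locallyIntegrableOn _,
    hu'.locallyIntegrable.locallyIntegrableOn _, fun φ hφ hc hs => ?_⟩
  have hφ' := (contDiff_partialDeriv i hφ).continuous
  have hc' := hasCompactSupport_partialDeriv i hc
  rw [setIntegral_eq_integral_of_tsupport_subset hs]
  refine (setIntegral_eq_integral_of_tsupport_subset
    ((tsupport_partialDeriv_subset i φ).trans hs)).trans ?_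
  exact integral_mul_fderiv_eq_neg_fderiv_mul_of_integrable
    ((hu'.mul hφ.continuous).integrable_of_hasCompactSupport hc.mul_left)
    ((hu.continuous.mul hφ').integrable_of_hasCompactSupport hc'.mul_left)
    ((hu.continuous.mul hφ.continuous).integrable_of_hasCompactSupport hc.mul_left)
    (fun x _ => hu.differentiable (by simp) x) (fun x _ => hφ.differentiable (by simp) x)

lemma comm (hΩ : IsOpen Ω) {uᵢ uⱼ uᵢⱼ uⱼᵢ : (Fin n → ℝ) → ℝ} (hi : HasWeakDeriv Ω i u uᵢ)
    (hj : HasWeakDeriv Ω j u uⱼ) (hij : HasWeakDeriv Ω j uᵢ uᵢⱼ) (hji : HasWeakDeriv Ω i uⱼ uⱼᵢ) :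
    uᵢⱼ =ᵐ[volume.restrict Ω] uⱼᵢ := by
  refine hij.ae_unique hΩ ⟨hi.2.1, hji.2.1, fun φ hφ hc hs => ?_⟩
  have test (i j : Fin n) {u u' : (Fin n → ℝ) → ℝ} (h : HasWeakDeriv Ω i u u') :
      ∫ x in Ω, u' x * partialDeriv j φ x = -∫ x in Ω, u x * partialDeriv i (partialDeriv j φ) x :=
    neg_eq_iff_eq_neg.1 (h.2.2 _ (contDiff_partialDeriv j hφ) (hasCompactSupport_partialDeriv j hc)
      ((tsupport_partialDeriv_subset j φ).trans hs)).symm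
  calc ∫ x in Ω, uᵢ x * partialDeriv j φ x
      = -∫ x in Ω, u x * partialDeriv i (partialDeriv j φ) x := test i j hi
    _ = -∫ x in Ω, u x * partialDeriv j (partialDeriv i φ) x := by
        rw [partialDeriv_comm i j (hφ.of_le ENat.LEInfty.out)]
    _ = ∫ x in Ω, uⱼ x * partialDeriv i φ x := (test j i hj).symm
    _ = -∫ x in Ω, uⱼᵢ x * φ x := hji.2.2 φ hφ hc hs

lemma hasWeakDeriv_weakDeriv (h : HasWeakDeriv Ω i u v) : HasWeakDeriv Ω i u (weakDeriv Ω i u) :=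
  Classical.epsilon_spec ⟨v, h⟩

lemma weakDeriv_ae_eq (hΩ : IsOpen Ω) (h : HasWeakDeriv Ω i u v) :
    weakDeriv Ω i u =ᵐ[volume.restrict Ω] v :=
  h.hasWeakDeriv_weakDeriv.ae_unique hΩ h

end HasWeakDeriv

namespace MemH

lemma memLp (h : MemH Ω k u) : MemLp u 2 (volume.restrict Ω) := by
  cases k with
  | zero => exact h
  | succ k => exact h.1

lemma congr (h : MemH Ω k u) (huv : u =ᵐ[volume.restrict Ω] v) : MemH Ω k v := by
  have hv := h.memLp.ae_eq huv
  cases k with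
  | zero => exact hv
  | succ k =>
    exact ⟨hv, fun i => (h.2 i).imp fun _ hw =>
      ⟨hw.1.congr (locallyIntegrableOn_of_memLp hv) huv, hw.2⟩⟩

lemma of_succ (h : MemH Ω (k + 1) u) : MemH Ω k u := by
  induction k generalizing u with
  | zero => exact h.1
  | succ k ih => exact ⟨h.1, fun i => (h.2 i).imp fun _ hw => ⟨hw.1, ih hw.2⟩⟩

lemma hasWeakDeriv (h : MemH Ω (k + 1) u) (i : Fin n) : HasWeakDeriv Ω i u (weakGrad Ω u i) :=
  (h.2 i).elim fun _ hv => hv.1.hasWeakDeriv_weakDeriv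

lemma weakGrad (hΩ : IsOpen Ω) (h : MemH Ω (k + 1) u) (i : Fin n) : MemH Ω k (weakGrad Ω u i) :=
  (h.2 i).elim fun _ hv => hv.2.congr (hv.1.weakDeriv_ae_eq hΩ).symm

lemma memLp_weakHess (hΩ : IsOpen Ω) (h : MemH Ω 2 u) (i j : Fin n) :
    MemLp (weakHess Ω u i j) 2 (volume.restrict Ω) :=
  ((h.weakGrad hΩ i).weakGrad hΩ j).memLp

lemma hasWeakDeriv_weakGrad (hΩ : IsOpen Ω) (h : MemH Ω 2 u) (i j : Fin n) :
    HasWeakDeriv Ω j (TimeReversal.weakGrad Ω u i) (weakHess Ω u i j) :=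
  (h.weakGrad hΩ i).hasWeakDeriv j

lemma weakHess_comm (hΩ : IsOpen Ω) (h : MemH Ω 2 u) (i j : Fin n) :
    weakHess Ω u i j =ᵐ[volume.restrict Ω] weakHess Ω u j i :=
  (h.hasWeakDeriv i).comm hΩ (h.hasWeakDeriv j) (h.hasWeakDeriv_weakGrad hΩ i j)
    (h.hasWeakDeriv_weakGrad hΩ j i)

end MemH

lemma l2NormSq_congr (h : u =ᵐ[volume.restrict Ω] v) : l2NormSq Ω u = l2NormSq Ω v :=
  integral_congr_ae (h.mono fun x hx => by simp only [hx])

lemma ae_eq_of_l2NormSq_sub_eq_zero (hu : MemLp u 2 (volume.restrict Ω))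
    (hv : MemLp v 2 (volume.restrict Ω)) (h : l2NormSq Ω (u - v) = 0) :
    u =ᵐ[volume.restrict Ω] v := by
  have hsq := (integral_eq_zero_iff_of_nonneg (fun _ => sq_nonneg _) (hu.sub hv).integrable_sq).1 h
  exact hsq.mono fun x hx => sub_eq_zero.1 (pow_eq_zero_iff two_ne_zero |>.1 hx)

lemma l2NormSq_le_two_mul_add (hu : MemLp u 2 (volume.restrict Ω))
    (hv : MemLp v 2 (volume.restrict Ω)) :
    l2NormSq Ω u ≤ 2 * l2NormSq Ω (u - v) + 2 * l2NormSq Ω v := by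
  simpa [l2NormSq] using integral_add_sq_le (hu.sub hv) hv

lemma sum_l2NormSq_nonneg (V : Fin n → (Fin n → ℝ) → ℝ) : 0 ≤ ∑ i, l2NormSq Ω (V i) :=
  Finset.sum_nonneg fun _ _ => l2NormSq_nonneg _ _

lemma sq_h1Norm (hΩ : IsOpen Ω) (hV : ∀ i, HasWeakDeriv Ω i u (V i)) :
    h1Norm Ω u ^ 2 = l2NormSq Ω u + ∑ i, l2NormSq Ω (V i) := by
  rw [h1Norm, Real.sq_sqrt (add_nonneg (l2NormSq_nonneg _ _) (sum_l2NormSq_nonneg _))]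
  exact congrArg _ (Finset.sum_congr rfl fun i _ => l2NormSq_congr ((hV i).weakDeriv_ae_eq hΩ))

lemma l2NormSq_le_sq_h1Norm (hΩ : IsOpen Ω) (hV : ∀ i, HasWeakDeriv Ω i u (V i)) :
    l2NormSq Ω u ≤ h1Norm Ω u ^ 2 :=
  sq_h1Norm hΩ hV ▸ le_add_of_nonneg_right (sum_l2NormSq_nonneg V)

lemma l2NormSq_deriv_le_sq_h1Norm (hΩ : IsOpen Ω) (hV : ∀ i, HasWeakDeriv Ω i u (V i))
    (i : Fin n) : l2NormSq Ω (V i) ≤ h1Norm Ω u ^ 2 :=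
  sq_h1Norm hΩ hV ▸ le_add_of_nonneg_of_le (l2NormSq_nonneg _ _)
    (Finset.single_le_sum (fun i _ => l2NormSq_nonneg Ω (V i)) (Finset.mem_univ i))

lemma sq_h1Norm_sub (hΩ : IsOpen Ω) (hu : MemH Ω 1 u) (hv : MemH Ω 1 v) :
    h1Norm Ω (u - v) ^ 2 =
      l2NormSq Ω (u - v) + ∑ i, l2NormSq Ω ((weakGrad Ω u - weakGrad Ω v) i) :=
  sq_h1Norm hΩ fun i => (hu.hasWeakDeriv i).sub (hv.hasWeakDeriv i)

lemma sq_h1Norm_le_two_mul_add (hΩ : IsOpen Ω) (hu : MemH Ω 1 u) (hv : MemH Ω 1 v) :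
    h1Norm Ω u ^ 2 ≤ 2 * h1Norm Ω (u - v) ^ 2 + 2 * h1Norm Ω v ^ 2 := by
  have hgrad := Finset.sum_le_sum fun i (_ : i ∈ Finset.univ) =>
    l2NormSq_le_two_mul_add (hu.weakGrad hΩ i).memLp (hv.weakGrad hΩ i).memLp
  rw [Finset.sum_add_distrib, ← Finset.mul_sum, ← Finset.mul_sum] at hgrad
  rw [sq_h1Norm hΩ hu.hasWeakDeriv, sq_h1Norm hΩ hv.hasWeakDeriv, sq_h1Norm_sub hΩ hu hv]
  have hfun := l2NormSq_le_two_mul_add hu.memLp hv.memLp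
  simp only [Pi.sub_apply]
  linarith

lemma sq_h2Norm (hΩ : IsOpen Ω) (hu : MemH Ω 1 u) :
    h2Norm Ω u ^ 2 = h1Norm Ω u ^ 2 + ∑ i, ∑ j ∈ Finset.Ici i, l2NormSq Ω (weakHess Ω u i j) := by
  have hhess : 0 ≤ ∑ i, ∑ j ∈ Finset.Ici i, l2NormSq Ω (weakHess Ω u i j) :=
    Finset.sum_nonneg fun _ _ => Finset.sum_nonneg fun _ _ => l2NormSq_nonneg _ _
  have hgrad := sq_h1Norm hΩ hu.hasWeakDeriv
  rw [hgrad]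
  exact Real.sq_sqrt (add_nonneg (hgrad ▸ sq_nonneg (h1Norm Ω u)) hhess)

lemma sq_h1Norm_le_sq_h2Norm (hΩ : IsOpen Ω) (hu : MemH Ω 1 u) :
    h1Norm Ω u ^ 2 ≤ h2Norm Ω u ^ 2 := by
  rw [sq_h2Norm hΩ hu]
  exact le_add_of_nonneg_right
    (Finset.sum_nonneg fun _ _ => Finset.sum_nonneg fun _ _ => l2NormSq_nonneg _ _)

lemma sum_l2NormSq_weakHess_self_le (hΩ : IsOpen Ω) (hu : MemH Ω 1 u) :
    ∑ i, l2NormSq Ω (weakHess Ω u i i) ≤ h2Norm Ω u ^ 2 := by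
  rw [sq_h2Norm hΩ hu]
  refine le_add_of_nonneg_of_le (sq_nonneg _) (Finset.sum_le_sum fun i _ => ?_)
  exact Finset.single_le_sum (f := fun j => l2NormSq Ω (weakHess Ω u i j))
    (fun _ _ => l2NormSq_nonneg _ _) (Finset.mem_Ici.2 le_rfl)

lemma l2NormSq_sum_le {ι : Type*} (s : Finset ι) {f : ι → (Fin n → ℝ) → ℝ}
    (hf : ∀ a ∈ s, MemLp (f a) 2 (volume.restrict Ω)) :
    l2NormSq Ω (∑ a ∈ s, f a) ≤ s.card * ∑ a ∈ s, l2NormSq Ω (f a) := by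
  have hsq (a) (ha : a ∈ s) := (hf a ha).integrable_sq
  simp only [l2NormSq]
  rw [← integral_finsetSum s hsq, ← integral_const_mul]
  refine integral_mono (memLp_finsetSum' s hf).integrable_sq
    ((integrable_finsetSum s hsq).const_mul _) fun x => ?_
  simpa using sq_sum_le_card_mul_sum_sq (s := s) (f := fun a => f a x)

lemma l2NormSq_waveOperator_weakHess_le (hΩ : IsOpen Ω) (hu : MemH Ω 2 u) (t : Fin n) :
    l2NormSq Ω (waveOperator t (weakHess Ω u)) ≤ n * h2Norm Ω u ^ 2 := by
  let f (i : Fin n) := if i = t then weakHess Ω u i i else -weakHess Ω u i i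
  have hf : waveOperator t (weakHess Ω u) = ∑ i, f i := by
    rw [Fintype.sum_eq_add_sum_compl t, waveOperator, sub_eq_add_neg, ← Finset.sum_neg_distrib]
    refine congrArg₂ (· + ·) (if_pos rfl).symm (Finset.sum_congr rfl fun i hi => ?_)
    exact (if_neg (by simpa using hi)).symm
  have hf_memLp (i) : MemLp (f i) 2 (volume.restrict Ω) := by
    have hi := hu.memLp_weakHess hΩ i i
    unfold f
    split_ifs
    exacts [hi, hi.neg]
  have hf_norm (i) : l2NormSq Ω (f i) = l2NormSq Ω (weakHess Ω u i i) := by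
    unfold f
    split_ifs <;> simp [l2NormSq]
  calc l2NormSq Ω (waveOperator t (weakHess Ω u))
      ≤ n * ∑ i, l2NormSq Ω (weakHess Ω u i i) := by
        simpa [hf, hf_norm] using l2NormSq_sum_le Finset.univ fun i _ => hf_memLp i
    _ ≤ n * h2Norm Ω u ^ 2 := by
        gcongr
        exact sum_l2NormSq_weakHess_self_le hΩ hu.of_succ

end Sobolev

section BoxProblem

variable {n : ℕ} {lo hi : Fin (n + 1) → ℝ}

lemma IsTrace.hasTrace {i : Fin (n + 1)} {c : ℝ} {v : (Fin (n + 1) → ℝ) → ℝ}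
    {V : Fin (n + 1) → (Fin (n + 1) → ℝ) → ℝ} {h : (Fin n → ℝ) → ℝ}
    (hv : IsTrace lo hi i c v h) (hV : ∀ j, HasWeakDeriv (box lo hi) j v (V j)) :
    HasTrace lo hi i c v V h := by
  obtain ⟨hv, hh, φ, hφ, hφv, hφh⟩ := hv
  have hderiv (k) (j) : HasWeakDeriv (box lo hi) j (φ k - v) (partialDeriv j (φ k) - V j) :=
    (HasWeakDeriv.of_contDiff (hφ k)).sub (hV j)
  have hlim : Tendsto (fun k => h1Norm (box lo hi) (φ k - v) ^ 2) atTop (𝓝 (0 ^ 2)) := hφv.pow 2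
  rw [zero_pow two_ne_zero] at hlim
  refine ⟨φ, ⟨hφ, ?_, fun j => ?_⟩, ?_⟩
  · exact .of_tendsto_integral_sq (fun k => memLp_of_continuous (hφ k).continuous) hv.memLp
      (squeeze_zero (fun _ => l2NormSq_nonneg _ _)
        (fun k => l2NormSq_le_sq_h1Norm isOpen_box (hderiv k)) hlim)
  · have hVj := (hv.weakGrad isOpen_box j).memLp.ae_eq ((hV j).weakDeriv_ae_eq isOpen_box)
    exact .of_tendsto_integral_sq
      (fun k => memLp_of_continuous (contDiff_partialDeriv j (hφ k)).continuous) hVj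
      (squeeze_zero (fun _ => l2NormSq_nonneg _ _)
        (fun k => l2NormSq_deriv_le_sq_h1Norm isOpen_box (hderiv k) j) hlim)
  · exact .of_tendsto_integral_sq
      (fun k => memLp_of_continuous (continuous_faceRestrict i c (hφ k).continuous)) hh hφh

lemma MixedConditions.sq_h1Norm_sub_le {t m : Fin (n + 1)} {d : (Fin n → ℝ) → ℝ}
    {u v : (Fin (n + 1) → ℝ) → ℝ} (hlt : ∀ i, lo i < hi i)
    (hu : MemH (box lo hi) 1 u) (hv : MemH (box lo hi) 1 v)
    (hu_mixed : MixedConditions lo hi t m d u (weakGrad (box lo hi) u) (weakHess (box lo hi) u))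
    (hv_mixed : MixedConditions lo hi t m d v (weakGrad (box lo hi) v) (weakHess (box lo hi) v)) :
    h1Norm (box lo hi) (u - v) ^ 2 ≤
      4 * (hi t - lo t) ^ 2 * (1 + 4 * (hi t - lo t) ^ 2) *
        l2NormSq (box lo hi) (waveOperator t (weakHess (box lo hi) u) -
          waveOperator t (weakHess (box lo hi) v)) := by
  have hdiff := hu_mixed.sub hv_mixed
  rw [sub_self] at hdiff
  rw [sq_h1Norm_sub isOpen_box hu hv, ← waveOperator_sub]
  exact hdiff.energy_le hlt

end BoxProblem

/-! ### The time-reversed problem -/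

section TimeReversedProblem

variable {a b T C : ℝ} {g : (Fin 3 → ℝ) → ℝ} {u v F : (Fin 4 → ℝ) → ℝ}

lemma qLo_lt_qHi (hab : b < a) (hT : 0 < T) (i : Fin 4) : qLo b i < qHi a T i := by
  fin_cases i <;> simp [qLo, qHi, hab, hT] <;> norm_num

lemma isOpen_QT : IsOpen (QT a b T) := isOpen_box

lemma HomogeneousConditions.mixedConditions (h : HomogeneousConditions a b T u)
    (hu : MemH (QT a b T) 2 u) (hd : DirichletData a b T g u) :
    MixedConditions (qLo b) (qHi a T) 3 2 (fun y => g ![y 0, y 1, T - y 2]) u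
      (weakGrad (QT a b T) u) (weakHess (QT a b T) u) := by
  have hgrad := hu.hasWeakDeriv
  have hhess := hu.hasWeakDeriv_weakGrad isOpen_QT
  have habsorbing : (fun p => -weakDeriv (QT a b T) 2 u p + weakDeriv (QT a b T) 3 u p) =
      weakGrad (QT a b T) u 3 - weakGrad (QT a b T) u 2 := funext fun _ => neg_add_eq_sub _ _
  have hneumann {i c} (hi : IsTrace (qLo b) (qHi a T) i c (-weakGrad (QT a b T) u i) 0) :
      HasTrace (qLo b) (qHi a T) i c (weakGrad (QT a b T) u i) (weakHess (QT a b T) u i) 0 := by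
    have hneg := (hi.hasTrace fun j => (hhess i j).neg).neg
    rwa [neg_neg, neg_zero, show (-fun j => -weakHess (QT a b T) u i j) = weakHess (QT a b T) u i
      from neg_neg _] at hneg
  exact
  { symm := hu.weakHess_comm isOpen_QT
    initial := h.initial.hasTrace hgrad
    initial_deriv := h.initial_deriv.hasTrace (hhess 3)
    dirichlet := IsTrace.hasTrace hd hgrad
    absorbing := (habsorbing ▸ h.absorbing).hasTrace fun j => (hhess 3 j).sub (hhess 2 j)
    neumann_lo := fun i ht hm => by
      fin_cases i
      · exact hneumann h.neumann_x_lo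
      · exact hneumann h.neumann_y_lo
      · exact absurd rfl hm
      · exact absurd rfl ht
    neumann_hi := fun i ht hm => by
      fin_cases i
      · exact h.neumann_x_hi.hasTrace (hhess 0)
      · exact h.neumann_y_hi.hasTrace (hhess 1)
      · exact absurd rfl hm
      · exact absurd rfl ht }

lemma IsSolution.waveOperator_ae_eq_zero (hu : IsSolution a b T g u) :
    waveOperator 3 (weakHess (QT a b T) u) =ᵐ[volume.restrict (QT a b T)] 0 := by
  filter_upwards [hu.wave] with p hp
  have hspace : ({3}ᶜ : Finset (Fin 4)) = {0, 1, 2} := by decide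
  simp [waveOperator, weakHess, weakGrad, hspace, hp, add_assoc]

lemma IsSolution.sq_h1Norm_sub_le (hu : IsSolution a b T g u) (hab : b < a) (hT : 0 < T)
    (hv : MemH (QT a b T) 2 v) (hv_hom : HomogeneousConditions a b T v)
    (hv_data : DirichletData a b T g v) :
    h1Norm (QT a b T) (u - v) ^ 2 ≤
      4 * T ^ 2 * (1 + 4 * T ^ 2) *
        l2NormSq (QT a b T) (waveOperator 3 (weakHess (QT a b T) v)) := by
  have hwave : l2NormSq (QT a b T) (waveOperator 3 (weakHess (QT a b T) u) -
      waveOperator 3 (weakHess (QT a b T) v)) =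
      l2NormSq (QT a b T) (waveOperator 3 (weakHess (QT a b T) v)) :=
    integral_congr_ae (hu.waveOperator_ae_eq_zero.mono fun p hp => by simp [hp])
  have htime : qHi a T 3 - qLo b 3 = T := by simp [qHi, qLo]
  have henergy := (hu.homogeneous.mixedConditions hu.memH hu.dirichlet).sq_h1Norm_sub_le
    (qLo_lt_qHi hab hT) hu.memH.of_succ hv.of_succ (hv_hom.mixedConditions hv hv_data)
  rwa [htime, ← QT, hwave] at henergy

lemma IsSolution.ae_unique (hu : IsSolution a b T g u) (hv : IsSolution a b T g v) (hab : b < a)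
    (hT : 0 < T) : u =ᵐ[volume.restrict (QT a b T)] v := by
  have henergy := hu.sq_h1Norm_sub_le hab hT hv.memH hv.homogeneous hv.dirichlet
  have hwave : l2NormSq (QT a b T) (waveOperator 3 (weakHess (QT a b T) v)) = 0 :=
    (l2NormSq_congr hv.waveOperator_ae_eq_zero).trans (by simp [l2NormSq])
  have hnorm := l2NormSq_le_sq_h1Norm isOpen_QT fun i =>
    (hu.memH.hasWeakDeriv i).sub (hv.memH.hasWeakDeriv i)
  rw [hwave, mul_zero] at henergy
  exact ae_eq_of_l2NormSq_sub_eq_zero hu.memH.memLp hv.memH.memLp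
    (le_antisymm (hnorm.trans henergy) (l2NormSq_nonneg _ _))

lemma IsSolution.h1Norm_le (hu : IsSolution a b T g u) (hab : b < a) (hT : 0 < T)
    (hF : MemH (QT a b T) 2 F) (hF_hom : HomogeneousConditions a b T F)
    (hF_data : DirichletData a b T g F) :
    h1Norm (QT a b T) u ≤ √(32 * T ^ 2 * (1 + 4 * T ^ 2) + 2) * h2Norm (QT a b T) F := by
  have henergy := hu.sq_h1Norm_sub_le hab hT hF hF_hom hF_data
  have hwave := l2NormSq_waveOperator_weakHess_le isOpen_QT hF 3
  have hlifting := sq_h1Norm_le_sq_h2Norm isOpen_QT hF.of_succ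
  have hF_nonneg : 0 ≤ h2Norm (QT a b T) F := Real.sqrt_nonneg _
  have hsq : h1Norm (QT a b T) u ^ 2 ≤
      (32 * T ^ 2 * (1 + 4 * T ^ 2) + 2) * h2Norm (QT a b T) F ^ 2 :=
    calc h1Norm (QT a b T) u ^ 2
        ≤ 2 * h1Norm (QT a b T) (u - F) ^ 2 + 2 * h1Norm (QT a b T) F ^ 2 :=
          sq_h1Norm_le_two_mul_add isOpen_QT hu.memH.of_succ hF.of_succ
      _ ≤ 2 * (4 * T ^ 2 * (1 + 4 * T ^ 2) * ((4 : ℕ) * h2Norm (QT a b T) F ^ 2)) +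
          2 * h2Norm (QT a b T) F ^ 2 := by
          gcongr
          exact henergy.trans (by gcongr)
      _ = _ := by push_cast; ring
  calc h1Norm (QT a b T) u = √(h1Norm (QT a b T) u ^ 2) := (Real.sqrt_sq (Real.sqrt_nonneg _)).symm
    _ ≤ √((32 * T ^ 2 * (1 + 4 * T ^ 2) + 2) * h2Norm (QT a b T) F ^ 2) := Real.sqrt_le_sqrt hsq
    _ = _ := by rw [Real.sqrt_mul (by positivity), Real.sqrt_sq hF_nonneg]

end TimeReversedProblem

end TimeReversal

end

theorem theorem1_general (T C : ℝ) (hT : 0 < T) (hC : 0 < C) :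
    ∃ C₁ : ℝ, 0 < C₁ ∧
      ∀ (a b : ℝ), b < a → ∀ (g : (Fin 3 → ℝ) → ℝ) (u : (Fin 4 → ℝ) → ℝ),
        TimeReversal.MemH (TimeReversal.GammaM T) 2 g →
        (∃ F : (Fin 4 → ℝ) → ℝ, TimeReversal.IsLifting a b T C g F) →
        TimeReversal.IsSolution a b T g u →
          (∀ v : (Fin 4 → ℝ) → ℝ, TimeReversal.IsSolution a b T g v →
            v =ᵐ[volume.restrict (TimeReversal.QT a b T)] u) ∧
          TimeReversal.h1Norm (TimeReversal.QT a b T) u ≤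
            C₁ * TimeReversal.h2Norm (TimeReversal.GammaM T) g := by
  refine ⟨√(32 * T ^ 2 * (1 + 4 * T ^ 2) + 2) * C, by positivity, ?_⟩
  rintro a b hab g u - ⟨F, hF⟩ hu
  refine ⟨fun v hv => hv.ae_unique hu hab hT, ?_⟩
  calc TimeReversal.h1Norm (TimeReversal.QT a b T) u
      ≤ √(32 * T ^ 2 * (1 + 4 * T ^ 2) + 2) * TimeReversal.h2Norm (TimeReversal.QT a b T) F :=
        hu.h1Norm_le hab hT hF.memH hF.homogeneous hF.dirichlet
    _ ≤ √(32 * T ^ 2 * (1 + 4 * T ^ 2) + 2) * (C * TimeReversal.h2Norm (TimeReversal.GammaM T) g) :=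
        mul_le_mul_of_nonneg_left hF.bound (Real.sqrt_nonneg _)
    _ = _ := (mul_assoc _ _ _).symm

theorem theorem1 (a b T C : ℝ) (ha : 0 < a) (hb : b < 0) (hT : 0 < T) (hC : 0 < C) :
    ∃ C₁ : ℝ, 0 < C₁ ∧
      ∀ (g : (Fin 3 → ℝ) → ℝ) (u : (Fin 4 → ℝ) → ℝ),
        TimeReversal.MemH (TimeReversal.GammaM T) 2 g →
        (∃ F : (Fin 4 → ℝ) → ℝ, TimeReversal.IsLifting a b T C g F) →
        TimeReversal.IsSolution a b T g u →
          (∀ v : (Fin 4 → ℝ) → ℝ, TimeReversal.IsSolution a b T g v →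
            v =ᵐ[volume.restrict (TimeReversal.QT a b T)] u) ∧
          TimeReversal.h1Norm (TimeReversal.QT a b T) u ≤
            C₁ * TimeReversal.h2Norm (TimeReversal.GammaM T) g := by
  obtain ⟨C₁, hC₁, h⟩ := theorem1_general T C hT hC
  exact ⟨C₁, hC₁, h a b (hb.trans ha)⟩
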